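/- **Setting.** Let $c,R_{\mathrm e},H_a>0$, $H_s>H_a$, $\kappa_s>0$, $\lambda_u\ge 0$, $p_u^t\in[0,1]$, $\lambda_a^0>0$, $\check d\ge 0$, and for each hop $i\in\{1,2\}$ let $P_i,\iota_i,D_i,f_i,l_i,\Omega_i,\theta_i,\sigma_i>0$ and let $m_i\ge 1$ be an integer. Put $$p_a(\check d)=\frac{1-e^{-\lambda_a^0\pi\check d^2}}{\lambda_a^0\pi\check d^2}\ (\check d>0),\quad p_a(0)=1,\qquad \lambda_a=\lambda_a^0p_a(\check d),\qquad \lambda_1=p_u^t\lambda_u,\quad \lambda_2=\lambda_a .$$ The transmitters of hop $1$ (ground users) lie on the sphere of radius $R_{\mathrm e}$ about the origin, and the receiver (an aerial vehicle, AV) is at distance $R_{\mathrm e}+H_a$ from the origin. The transmitters of hop $2$ (AVs) lie on the sphere of radius $R_{\mathrm e}+H_a$, and the receiver (a satellite) is at distance $R_{\mathrm e}+H_s$ from the origin. The coverage region $\mathcal A_1$ is the spherical cap of height $H_1=1/(2\pi\lambda_aR_{\mathrm e})$ (that is, of area $1/\lambda_a$) centred below the AV, where $H_1\le 2R_{\mathrm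 e}$. The coverage region $\mathcal A_2$ is the set of points of the AV sphere that are on the near side of the satellite's horizon and are seen from the satellite within the angle $\vartheta_s$ of the downward vertical, where $\vartheta_s$ equals $c\kappa_s/(f_2D_2)$ degrees, $\vartheta_s<90^\circ$ and $(R_{\mathrm e}+H_s)\sin\vartheta_s\le R_{\mathrm e}+H_a$. (The conditions on $H_1$ and on $\vartheta_s$ are needed for hop $1$ and hop $2$ respectively.) Let $r_i(\mathtt t)$ be the distance from $\mathtt t$ to the receiver, $G_i=\iota_i(\pi D_if_i/c)^2$ and $L_i(\mathtt t)=l_i\left(\frac{c}{4\pi f_i}\right)^2r_i(\mathtt t)^{-2}$. A link from a transmitter $\mathtt t_0\in\mathcal A_i$ to the receiver has $$\mathtt{SINR}_i=\frac{P_iG_ih_iL_i(\mathtt t_0)}{I_i+\sigma_i^2},\qquad I_i=\sum_{\mathtt t\in\Phi_i'}P_iG_ih_{i,\mathtt t}L_i(\mathtt t),$$ where the set $\Phi_i'$ of interferers (the other transmitters) is a homogeneous Poisson point process on $\mathcal A_i$ with density $\lambda_i$ with respect to surface area (for $i=2$ this is the Poisson approximation of the Matérn hard-core process of the AVs), all channel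 power gains $h_i,h_{i,\mathtt t}$ are independent with the Gamma density $\frac{m_i^{m_i}}{\Gamma(m_i)\Omega_i^{m_i}}h^{m_i-1}e^{-m_ih/\Omega_i}$, $h>0$ (Nakagami-$m_i$ fading), and the location of $\mathtt t_0$, the process $\Phi_i'$ and the gains are mutually independent. **Proposition 1.** For each $i\in\{1,2\}$ and each location $\mathtt t_0\in\mathcal A_i$, writing $r_0=r_i(\mathtt t_0)$, the probability $\mathcal P_i=\mathbb P(\mathtt{SINR}_i>\theta_i)$ for the link from $\mathtt t_0$ is $$\mathcal P_i=\exp\left(-\dot S_i-\dot R_i\varepsilon_i\right)\sum_{k=0}^{m_i-1}\ \sum_{\substack{b_1,\dots,b_k\ge 0\\ b_1+2b_2+\cdots+kb_k=k}}\ \frac{\left(\dot S_i+\dot R_i\dot\varepsilon_i^{(1)}\right)^{b_1}\prod_{l=2}^{k}\left(\dot R_i\dot\varepsilon_i^{(l)}\right)^{b_l}}{b_1!\,b_2!\cdots b_k!},$$ (the inner sum is $1$ for $k=0$), where $$\dot S_i=\frac{16\,m_i\theta_i\sigma_i^2r_0^2}{\Omega_iP_i\iota_il_iD_i^2},\qquad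 \dot R_1=\frac{\pi\lambda_1R_{\mathrm e}}{R_{\mathrm e}+H_a},\qquad \dot R_2=\frac{\pi\lambda_2(R_{\mathrm e}+H_a)}{R_{\mathrm e}+H_s},$$ $$\varepsilon_i=\int_{\check R_i^2}^{\hat R_i^2}\left(1-\left(1+\frac{\theta_ir_0^2}{\gamma}\right)^{-m_i}\right)\mathrm d\gamma,\qquad \dot\varepsilon_i^{(l)}=\binom{m_i+l-1}{l}\int_{\check R_i^2}^{\hat R_i^2}\left(\frac{\theta_ir_0^2}{\gamma}\right)^{l}\left(1+\frac{\theta_ir_0^2}{\gamma}\right)^{-m_i-l}\mathrm d\gamma,$$ $$\check R_1=H_a,\quad \hat R_1=\sqrt{H_a^2+2H_1(R_{\mathrm e}+H_a)},\quad \check R_2=H_s-H_a,$$ $$\hat R_2=(R_{\mathrm e}+H_s)\cos\vartheta_s-\sqrt{(R_{\mathrm e}+H_a)^2-(R_{\mathrm e}+H_s)^2\sin^2\vartheta_s}.$$ Moreover, if the location of $\mathtt t_0$ in $\mathcal A_i$ is random, this expression, with $r_0=r_i(\mathtt t_0)$, is almost surely the conditional probability of $\{\mathtt{SINR}_i>\theta_i\}$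 given $\mathtt t_0$. -/

import Mathlib

open MeasureTheory ProbabilityTheory
open scoped Real

namespace GASS

/-- Three-dimensional Euclidean space; the Earth's centre is the origin. -/
abbrev Space : Type := EuclideanSpace ℝ (Fin 3)

/-- The two hops: ground user to aerial vehicle (AV), and AV to satellite. -/
inductive Hop : Type
  | first : Hop
  | second : Hop

/-- The system parameters, with their signs. -/
structure Params where
  /-- speed of light (in the units in use) -/
  c : ℝ
  /-- Earth radius -/
  Re : ℝ
  /-- altitude of the AVs above the ground -/
  Ha : ℝ
  /-- altitude of the satellite above the ground -/
  Hs : ℝ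
  /-- density of ground users -/
  lamU : ℝ
  /-- probability that a ground user transmits -/
  pT : ℝ
  /-- density of the Poisson process whose hard-core thinning gives the AVs -/
  lamA0 : ℝ
  /-- hard-core distance between AVs -/
  dMin : ℝ
  /-- beamwidth constant of the satellite antenna -/
  kappa : ℝ
  /-- transmission power -/
  P : Hop → ℝ
  /-- antenna illumination coefficient -/
  iota : Hop → ℝ
  /-- diameter of the receiving antenna -/
  D : Hop → ℝ
  /-- carrier frequency -/
  f : Hop → ℝ
  /-- additional (atmospheric) loss factor -/
  loss : Hop → ℝ
  /-- Nakagami shape parameter, an integer -/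
  m : Hop → ℕ
  /-- Nakagami spread parameter -/
  spread : Hop → ℝ
  /-- SINR threshold -/
  theta : Hop → ℝ
  /-- standard deviation of the noise, so that the noise power is its square -/
  sigma : Hop → ℝ
  c_pos : 0 < c
  Re_pos : 0 < Re
  Ha_pos : 0 < Ha
  Ha_lt_Hs : Ha < Hs
  lamU_nonneg : 0 ≤ lamU
  pT_nonneg : 0 ≤ pT
  pT_le_one : pT ≤ 1
  lamA0_pos : 0 < lamA0
  dMin_nonneg : 0 ≤ dMin
  kappa_pos : 0 < kappa
  P_pos : ∀ i, 0 < P i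
  iota_pos : ∀ i, 0 < iota i
  D_pos : ∀ i, 0 < D i
  f_pos : ∀ i, 0 < f i
  loss_pos : ∀ i, 0 < loss i
  m_pos : ∀ i, 1 ≤ m i
  spread_pos : ∀ i, 0 < spread i
  theta_pos : ∀ i, 0 < theta i
  sigma_pos : ∀ i, 0 < sigma i

noncomputable section

namespace Params

variable (S : Params)

/-! ### Densities and geometry -/

/-- Probability that a point survives the Matérn type II thinning. -/
def retain : ℝ :=
  if S.dMin = 0 then 1
  else (1 - Real.exp (-(S.lamA0 * π * S.dMin ^ 2))) / (S.lamA0 * π * S.dMin ^ 2)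

/-- Density of the AVs. -/
def lamA : ℝ := S.lamA0 * S.retain

/-- Density of the transmitters of each hop. -/
def density : Hop → ℝ
  | .first => S.pT * S.lamU
  | .second => S.lamA

/-- Radius of the sphere that carries the transmitters of each hop. -/
def txRadius : Hop → ℝ
  | .first => S.Re
  | .second => S.Re + S.Ha

/-- Distance of the receiver of each hop from the Earth's centre. -/
def rxRadius : Hop → ℝ
  | .first => S.Re + S.Ha
  | .second => S.Re + S.Hs

/-- Location of the receiver of each hop, in the direction of the unit vector `u`. -/
def receiver (i : Hop) (u : Space) : Space := S.rxRadius i • u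

/-- Height of the ground cap of area `1 / lamA` (the mean area of a Voronoi cell of the AVs). -/
def capHeight : ℝ := 1 / (2 * π * S.lamA * S.Re)

/-- Beam angle of the satellite; `c * kappa / (f * D)` is its value in degrees, and it is
converted to radians here. -/
def beam : ℝ := S.c * S.kappa / (S.f .second * S.D .second) * (π / 180)

/-- The coverage region of the receiver of each hop. For the first hop it is the ground cap of
height `capHeight` below the AV. For the second hop it is the set of points of the AV sphere that
are visible from the satellite (on the near side of its horizon) and that lie within the beam
angle of the vertical. -/
def coverage (i : Hop) (u : Space) : Set Space :=
  match i with
  | .first => {x | ‖x‖ = S.Re ∧ S.Re - S.capHeight ≤ inner ℝ x u}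
  | .second => {x | ‖x‖ = S.Re + S.Ha ∧
      (S.Re + S.Ha) ^ 2 ≤ (S.Re + S.Hs) * inner ℝ x u ∧
      InnerProductGeometry.angle (S.receiver .second u - x) u ≤ S.beam}

/-- The coverage region is a proper cap: the area `1 / lamA` does not exceed the area of the
Earth's surface, respectively the (acute) beam of the satellite meets the AV sphere along its whole
boundary. -/
def CapFits : Hop → Prop
  | .first => S.capHeight ≤ 2 * S.Re
  | .second => S.beam < π / 2 ∧ (S.Re + S.Hs) * Real.sin S.beam ≤ S.Re + S.Ha

/-- Surface area on the sphere of radius `R` about the origin, as a measure on space. -/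
def sphereArea (R : ℝ) : Measure Space :=
  ENNReal.ofReal (R ^ 2) •
    (volume : Measure Space).toSphere.map
      (fun x : Metric.sphere (0 : Space) 1 => R • (x : Space))

/-- Intensity measure of the transmitters: constant density on the coverage region. -/
def intensity (i : Hop) (u : Space) : Measure Space :=
  ENNReal.ofReal (S.density i) • (sphereArea (S.txRadius i)).restrict (S.coverage i u)

/-! ### Transmission -/

/-- Receiver antenna gain. -/
def gain (i : Hop) : ℝ := S.iota i * (π * S.D i * S.f i / S.c) ^ 2

/-- Path loss at distance `r`. -/
def pathLoss (i : Hop) (r : ℝ) : ℝ := S.loss i * (S.c / (4 * π * S.f i)) ^ 2 * (r ^ 2)⁻¹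

/-- Power received from a transmitter at `t` with channel power gain `h`. -/
def rxPower (i : Hop) (u t : Space) (h : ℝ) : ℝ :=
  S.P i * S.gain i * h * S.pathLoss i (dist t (S.receiver i u))

/-- SINR of the link from `t₀`, when the interferers are at `x 0, …, x (n - 1)`; `g 0` is the
channel power gain of the link and `g (k + 1)` that of the interferer at `x k`. -/
def sinr (i : Hop) (u t₀ : Space) (n : ℕ) (x : ℕ → Space) (g : ℕ → ℝ) : ℝ :=
  S.rxPower i u t₀ (g 0) /
    ((∑ k ∈ Finset.range n, S.rxPower i u (x k) (g (k + 1))) + S.sigma i ^ 2)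

/-! ### The closed form -/

/-- Minimal link distance. -/
def rMin : Hop → ℝ
  | .first => S.Ha
  | .second => S.Hs - S.Ha

/-- Maximal link distance. -/
def rMax : Hop → ℝ
  | .first => √(S.Ha ^ 2 + 2 * S.capHeight * (S.Re + S.Ha))
  | .second => (S.Re + S.Hs) * Real.cos S.beam -
      √((S.Re + S.Ha) ^ 2 - (S.Re + S.Hs) ^ 2 * Real.sin S.beam ^ 2)

/-- The noise term at link distance `r₀`. -/
def Sdot (i : Hop) (r₀ : ℝ) : ℝ :=
  16 * S.m i * S.theta i * S.sigma i ^ 2 * r₀ ^ 2 /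
    (S.spread i * S.P i * S.iota i * S.loss i * S.D i ^ 2)

/-- The density factor. -/
def Rdot : Hop → ℝ
  | .first => π * S.density .first * S.Re / (S.Re + S.Ha)
  | .second => π * S.density .second * (S.Re + S.Ha) / (S.Re + S.Hs)

/-- The integral in the exponent. -/
def eps (i : Hop) (r₀ : ℝ) : ℝ :=
  ∫ y in (S.rMin i ^ 2)..(S.rMax i ^ 2), (1 - ((1 + S.theta i * r₀ ^ 2 / y) ^ S.m i)⁻¹)

/-- The integral of order `l`. -/
def epsD (i : Hop) (r₀ : ℝ) (l : ℕ) : ℝ :=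
  ((S.m i + l - 1).choose l : ℝ) *
    ∫ y in (S.rMin i ^ 2)..(S.rMax i ^ 2),
      (S.theta i * r₀ ^ 2 / y) ^ l * ((1 + S.theta i * r₀ ^ 2 / y) ^ (S.m i + l))⁻¹

/-- The base of the `l`-th power: the noise term enters for `l = 1` only. -/
def base (i : Hop) (r₀ : ℝ) (l : ℕ) : ℝ :=
  (if l = 1 then S.Sdot i r₀ else 0) + S.Rdot i * S.epsD i r₀ l

/-- The success probability at link distance `r₀`. The inner sum is over all natural numbers
`b 0, …, b (k - 1)` with `∑ j, (j + 1) * b j = k` (each of them is at most `k`). -/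
def successProb (i : Hop) (r₀ : ℝ) : ℝ :=
  Real.exp (-S.Sdot i r₀ - S.Rdot i * S.eps i r₀) *
    ∑ k ∈ Finset.range (S.m i),
      ∑ b : Fin k → Fin (k + 1) with ∑ j : Fin k, ((j : ℕ) + 1) * (b j : ℕ) = k,
        ∏ j : Fin k, S.base i r₀ ((j : ℕ) + 1) ^ (b j : ℕ) / ((b j : ℕ).factorial : ℝ)

end Params

/-! ### The random model -/

open Classical in
/-- The number of points in `B` of the finite point process `x 0, …, x (n - 1)`. -/
def count (n : ℕ) (x : ℕ → Space) (B : Set Space) : ℕ :=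
  ((Finset.range n).filter (fun k => x k ∈ B)).card

/-- `X 0, …, X (N - 1)` is a measurable enumeration of a Poisson point process with the finite
intensity measure `Λ`: the number of points in a measurable set is Poisson distributed, and the
numbers of points in pairwise disjoint measurable sets are independent. -/
structure IsPoissonProcess {Ω : Type*} [MeasurableSpace Ω] (μ : Measure Ω)
    (Λ : Measure Space) (N : Ω → ℕ) (X : ℕ → Ω → Space) : Prop where
  measurable_card : Measurable N
  measurable_point : ∀ n, Measurable (X n)
  law_count : ∀ B : Set Space, MeasurableSet B →
    μ.map (fun ω => count (N ω) (fun n => X n ω) B) = poissonMeasure (Λ B).toNNReal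
  indep_count : ∀ (k : ℕ) (B : Fin k → Set Space), (∀ j, MeasurableSet (B j)) →
    Pairwise (fun j j' => Disjoint (B j) (B j')) →
    iIndepFun (fun (j : Fin k) ω => count (N ω) (fun n => X n ω) (B j)) μ

/-- The random model of a link of hop `i` whose receiver lies in the direction `u`: the location
`T` of its transmitter lies in the coverage region, the interferers (the other transmitters) are a
homogeneous Poisson process on the coverage region, all channel power gains `g` are independent and
Gamma distributed with shape `m` and rate `m / spread` (Nakagami fading), and the transmitter
location, the interferer locations and the channel gains are mutually independent. -/
structure IsLinkModel (S : Params) (i : Hop) (u : Space) {Ω : Type*} [MeasurableSpace Ω]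
    (μ : Measure Ω) (T : Ω → Space) (N : Ω → ℕ) (X : ℕ → Ω → Space) (g : ℕ → Ω → ℝ) :
    Prop where
  measurable_tx : Measurable T
  tx_mem : ∀ᵐ ω ∂μ, T ω ∈ S.coverage i u
  poisson : IsPoissonProcess μ (S.intensity i u) N X
  measurable_gain : ∀ n, Measurable (g n)
  law_gain : ∀ n, μ.map (g n) = gammaMeasure (S.m i) (S.m i / S.spread i)
  indep_gain : iIndepFun g μ
  indep_location : IndepFun T (fun ω => (N ω, fun n => X n ω)) μ
  indep_fading : IndepFun (fun ω => (T ω, N ω, fun n => X n ω)) (fun ω n => g n ω) μ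

end

end GASS

/-!
By Archimedes' hat-box theorem, the squared distance from a uniform point of a sphere to a fixed
point off the origin is uniformly distributed, so the squared distances from the interferers to the
receiver form a homogeneous Poisson process on `[rMin ^ 2, rMax ^ 2]`. The link succeeds when its
gain, scaled to rate one, exceeds an independent level `Y ≥ 0`, and a Gamma tail of integer shape
`m` turns the probability of this into `∑ k < m, E[exp (-Y) * Y ^ k / k!]`. These Poisson weights
are the coefficients of the generating function `w ↦ E[exp (-(1 - w) * Y)]`, which the Laplace
functional of the marked Poisson process evaluates as the exponential of a function of `w`. The
negative binomial series expands that function, and the sum over `b₁ + 2 b₂ + ⋯ + k b_k = k` is the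
`k`-th coefficient of its exponential.
-/

namespace GASS

section Archimedes

open Set ENNReal

theorem lintegral_comp_sqrt_sq_add_sq {f : ℝ → ℝ≥0∞} (hf : Measurable f) :
    ∫⁻ w : ℝ × ℝ, f √(w.1 ^ 2 + w.2 ^ 2) =
      ENNReal.ofReal (2 * π) * ∫⁻ ρ in Ioi 0, ENNReal.ofReal ρ * f ρ := by
  have polar_norm : ∀ p ∈ polarCoord.target, ENNReal.ofReal p.1 •
      f √((polarCoord.symm p).1 ^ 2 + (polarCoord.symm p).2 ^ 2) =
        ENNReal.ofReal p.1 * f p.1 * 1 := by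
    intro p hp
    have hsq : (p.1 * Real.cos p.2) ^ 2 + (p.1 * Real.sin p.2) ^ 2 = p.1 ^ 2 := by
      linear_combination p.1 ^ 2 * Real.sin_sq_add_cos_sq p.2
    rw [polarCoord_symm_apply, hsq, Real.sqrt_sq (le_of_lt hp.1), smul_eq_mul, mul_one]
  rw [← lintegral_comp_polarCoord_symm,
    setLIntegral_congr_fun polarCoord.open_target.measurableSet polar_norm, polarCoord_target,
    Measure.volume_eq_prod, ← Measure.prod_restrict,
    lintegral_prod_mul (f := fun ρ => ENNReal.ofReal ρ * f ρ) (g := fun _ => 1) (by fun_prop)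
      (by fun_prop), mul_comm]
  simp [two_mul]

theorem lintegral_comp_sqrt_sq_add {f : ℝ → ℝ≥0∞} (z : ℝ) :
    ∫⁻ ρ in Ioi 0, ENNReal.ofReal ρ * f √(z ^ 2 + ρ ^ 2) =
      ∫⁻ r in Ioi |z|, ENNReal.ofReal r * f r := by
  have pos : ∀ ρ ∈ Ioi (0 : ℝ), 0 < z ^ 2 + ρ ^ 2 := fun ρ hρ =>
    add_pos_of_nonneg_of_pos (sq_nonneg z) (pow_pos hρ 2)
  have image_eq : (fun ρ : ℝ => √(z ^ 2 + ρ ^ 2)) '' Ioi 0 = Ioi |z| := by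
    ext r
    simp only [mem_image, mem_Ioi]
    constructor
    · rintro ⟨ρ, hρ, rfl⟩
      exact Real.lt_sqrt_of_sq_lt (by rw [sq_abs]; linarith [pow_pos hρ 2])
    · intro hr
      have hlt : z ^ 2 < r ^ 2 := sq_lt_sq.2 (hr.trans_le (le_abs_self r))
      refine ⟨√(r ^ 2 - z ^ 2), Real.sqrt_pos.2 (sub_pos.2 hlt), ?_⟩
      rw [Real.sq_sqrt (sub_nonneg.2 hlt.le), add_sub_cancel,
        Real.sqrt_sq ((abs_nonneg z).trans hr.le)]
  have deriv : ∀ ρ ∈ Ioi (0 : ℝ), HasDerivWithinAt (fun ρ : ℝ => √(z ^ 2 + ρ ^ 2))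
      (ρ / √(z ^ 2 + ρ ^ 2)) (Ioi 0) ρ := by
    intro ρ hρ
    have h := (((hasDerivAt_pow 2 ρ).const_add (z ^ 2)).sqrt (pos ρ hρ).ne').hasDerivWithinAt
      (s := Ioi 0)
    simpa [mul_div_mul_left] using h
  have inj : InjOn (fun ρ : ℝ => √(z ^ 2 + ρ ^ 2)) (Ioi 0) := by
    intro a ha b hb hab
    have hsq := (Real.sqrt_inj (pos a ha).le (pos b hb).le).1 hab
    exact (sq_eq_sq₀ (le_of_lt ha) (le_of_lt hb)).1 (add_left_cancel hsq)
  rw [← image_eq, lintegral_image_eq_lintegral_abs_deriv_mul measurableSet_Ioi deriv inj]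
  refine setLIntegral_congr_fun measurableSet_Ioi fun ρ hρ => ?_
  have hs : 0 < √(z ^ 2 + ρ ^ 2) := Real.sqrt_pos.2 (pos ρ hρ)
  have hρ' : 0 < ρ := hρ
  rw [← mul_assoc, ← ENNReal.ofReal_mul (abs_nonneg _), abs_of_pos (by positivity),
    div_mul_cancel₀ _ hs.ne']

theorem lintegral_Ioi_abs_swap {H : ℝ → ℝ → ℝ≥0∞} (hH : Measurable (Function.uncurry H)) :
    ∫⁻ z, ∫⁻ r in Ioi |z|, H z r = ∫⁻ r in Ioi 0, ∫⁻ z in Ioo (-r) r, H z r := by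
  have hset : MeasurableSet {p : ℝ × ℝ | |p.1| < p.2} :=
    measurableSet_lt (by fun_prop) (by fun_prop)
  set F := {p : ℝ × ℝ | |p.1| < p.2}.indicator (Function.uncurry H)
  have fst_section (z : ℝ) : ∫⁻ r in Ioi |z|, H z r = ∫⁻ r, F (z, r) :=
    (lintegral_indicator measurableSet_Ioi _).symm
  have snd_section (r : ℝ) : ∫⁻ z, F (z, r) =
      (Ioi 0).indicator (fun r => ∫⁻ z in Ioo (-r) r, H z r) r := by
    by_cases hr : 0 < r
    · have slice : Ioo (-r) r = (fun z => (z, r)) ⁻¹' {p : ℝ × ℝ | |p.1| < p.2} :=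
        ext fun z => abs_lt.symm
      rw [indicator_of_mem (mem_Ioi.2 hr), ← lintegral_indicator measurableSet_Ioo, slice]
      exact lintegral_congr fun z => (indicator_comp_right (fun z => (z, r))).symm
    · rw [indicator_of_notMem (notMem_Ioi.2 (not_lt.1 hr))]
      refine lintegral_eq_zero_of_ae_eq_zero (ae_of_all _ fun z => indicator_of_notMem ?_ _)
      exact fun h : |z| < r => hr ((abs_nonneg z).trans_lt h)
  calc ∫⁻ z, ∫⁻ r in Ioi |z|, H z r = ∫⁻ z, ∫⁻ r, F (z, r) := lintegral_congr fst_section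
    _ = ∫⁻ r, ∫⁻ z, F (z, r) := lintegral_lintegral_swap (f := fun z r => F (z, r))
      (hH.indicator hset).aemeasurable
    _ = ∫⁻ r, (Ioi 0).indicator (fun r => ∫⁻ z in Ioo (-r) r, H z r) r :=
      lintegral_congr snd_section
    _ = ∫⁻ r in Ioi 0, ∫⁻ z in Ioo (-r) r, H z r := lintegral_indicator measurableSet_Ioi _

theorem lintegral_Ioo_neg_self {r : ℝ} (hr : 0 < r) (f : ℝ → ℝ≥0∞) :
    ∫⁻ z in Ioo (-r) r, f z = ENNReal.ofReal r * ∫⁻ t in Ioo (-1) 1, f (r * t) := by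
  have image_eq : (fun t => r * t) '' Ioo (-1) 1 = Ioo (-r) r := by
    rw [image_mul_left_Ioo hr, mul_neg_one, mul_one]
  rw [← image_eq, lintegral_image_eq_lintegral_abs_deriv_mul measurableSet_Ioo
    (fun t _ => ((hasDerivAt_id' t).const_mul r).hasDerivWithinAt)
    (mul_right_injective₀ hr.ne').injOn, mul_one, abs_of_pos hr,
    lintegral_const_mul' _ _ ENNReal.ofReal_ne_top]

variable {E : Type*} [NormedAddCommGroup E] [InnerProductSpace ℝ E] [FiniteDimensional ℝ E]

theorem exists_orthonormalBasis_apply_zero_eq {n : ℕ} (hE : Module.finrank ℝ E = n + 1) {u : E}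
    (hu : ‖u‖ = 1) : ∃ b : OrthonormalBasis (Fin (n + 1)) ℝ E, b 0 = u := by
  have orthonormal_single : Orthonormal ℝ (({0} : Set (Fin (n + 1))).domRestrict fun _ => u) :=
    ⟨fun _ => hu, fun i j hij => (hij (Subsingleton.elim i j)).elim⟩
  obtain ⟨b, hb⟩ := orthonormal_single.exists_orthonormalBasis_extension_of_card_eq (by simp [hE])
  exact ⟨b, hb 0 rfl⟩

variable [MeasurableSpace E] [BorelSpace E]

theorem lintegral_inner_norm_eq_lintegral_prod (hE : Module.finrank ℝ E = 3) {u : E} (hu : ‖u‖ = 1)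
    {G : ℝ → ℝ → ℝ≥0∞} (hG : Measurable (Function.uncurry G)) :
    ∫⁻ y : E, G (inner ℝ y u) ‖y‖ =
      ∫⁻ z : ℝ, ∫⁻ w : ℝ × ℝ, G z √(z ^ 2 + (w.1 ^ 2 + w.2 ^ 2)) := by
  obtain ⟨b, hb⟩ := exists_orthonormalBasis_apply_zero_eq hE hu
  have coords : MeasurePreserving (fun y : E => (b.repr y 0, b.repr y 1, b.repr y 2)) :=
    ((MeasurePreserving.id volume).prod (volume_preserving_finTwoArrow ℝ)).comp
      ((volume_preserving_piFinSuccAbove (fun _ : Fin 3 => ℝ) 0).comp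
        ((PiLp.volume_preserving_ofLp (Fin 3)).comp b.measurePreserving_repr))
  have hF : Measurable fun p : ℝ × ℝ × ℝ => G p.1 √(p.1 ^ 2 + (p.2.1 ^ 2 + p.2.2 ^ 2)) :=
    hG.comp (measurable_fst.prodMk (by fun_prop))
  have inner_eq (y : E) : inner ℝ y u = b.repr y 0 := by
    rw [b.repr_apply_apply, hb, real_inner_comm]
  have norm_eq (y : E) : ‖y‖ = √(b.repr y 0 ^ 2 + (b.repr y 1 ^ 2 + b.repr y 2 ^ 2)) := by
    rw [← b.repr.norm_map y, EuclideanSpace.norm_eq, Fin.sum_univ_three]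
    simp [add_assoc]
  simp_rw [inner_eq, norm_eq]
  rw [coords.lintegral_comp hF, Measure.volume_eq_prod, lintegral_prod _ hF.aemeasurable]

theorem lintegral_inner_norm (hE : Module.finrank ℝ E = 3) {u : E} (hu : ‖u‖ = 1)
    {G : ℝ → ℝ → ℝ≥0∞} (hG : Measurable (Function.uncurry G)) :
    ∫⁻ y : E, G (inner ℝ y u) ‖y‖ = ENNReal.ofReal (2 * π) *
      ∫⁻ r in Ioi 0, ENNReal.ofReal (r ^ 2) * ∫⁻ t in Ioo (-1) 1, G (r * t) r := by
  have cylindrical (z : ℝ) : ∫⁻ w : ℝ × ℝ, G z √(z ^ 2 + (w.1 ^ 2 + w.2 ^ 2)) =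
      ENNReal.ofReal (2 * π) * ∫⁻ r in Ioi |z|, ENNReal.ofReal r * G z r := by
    have hGz : Measurable (G z) := hG.comp measurable_prodMk_left
    rw [← lintegral_comp_sqrt_sq_add,
      ← lintegral_comp_sqrt_sq_add_sq (f := fun ρ => G z √(z ^ 2 + ρ ^ 2)) (by fun_prop)]
    refine lintegral_congr fun w => ?_
    rw [Real.sq_sqrt (by positivity)]
  have hGr : Measurable (Function.uncurry fun z r => ENNReal.ofReal r * G z r) :=
    measurable_snd.ennreal_ofReal.mul hG
  rw [lintegral_inner_norm_eq_lintegral_prod hE hu hG]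
  simp_rw [cylindrical]
  rw [lintegral_const_mul' _ _ ENNReal.ofReal_ne_top, lintegral_Ioi_abs_swap hGr]
  congr 1
  refine setLIntegral_congr_fun measurableSet_Ioi fun r (hr : 0 < r) => ?_
  rw [lintegral_const_mul' _ _ ENNReal.ofReal_ne_top, lintegral_Ioo_neg_self hr, ← mul_assoc,
    ← ENNReal.ofReal_mul hr.le, ← sq]

theorem lintegral_toSphere [Nontrivial E] {f : E → ℝ≥0∞} (hf : Measurable f) :
    ∫⁻ x : Metric.sphere (0 : E) 1, f x ∂(volume : Measure E).toSphere =
      Module.finrank ℝ E * ∫⁻ y : E, f (‖y‖⁻¹ • y) * (Iio (1 : ℝ)).indicator 1 ‖y‖ := by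
  let one : Ioi (0 : ℝ) := ⟨1, mem_Ioi.2 one_pos⟩
  have hrank : (Module.finrank ℝ E : ℝ≥0∞) ≠ 0 := by simp [Module.finrank_pos.ne']
  have radial_mass : (Measure.volumeIoiPow (Module.finrank ℝ E - 1)) (Iio one) =
      (Module.finrank ℝ E : ℝ≥0∞)⁻¹ := by
    rw [Measure.volumeIoiPow_apply_Iio, one_pow, Nat.cast_sub Module.finrank_pos, Nat.cast_one,
      sub_add_cancel, one_div, ENNReal.ofReal_inv_of_pos (Nat.cast_pos.2 Module.finrank_pos),
      ENNReal.ofReal_natCast]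
  have polar : ∫⁻ y : E, f (‖y‖⁻¹ • y) * (Iio (1 : ℝ)).indicator 1 ‖y‖ =
      ∫⁻ p : Metric.sphere (0 : E) 1 × Ioi (0 : ℝ), f p.1 * (Iio one).indicator 1 p.2
        ∂(volume : Measure E).toSphere.prod (.volumeIoiPow (Module.finrank ℝ E - 1)) := by
    rw [← (volume : Measure E).measurePreserving_homeomorphUnitSphereProd.lintegral_comp_emb
      (Homeomorph.measurableEmbedding _), ← setLIntegral_univ,
      ← setLIntegral_congr (ae_eq_univ.2 (by simp : volume ({(0 : E)}ᶜᶜ) = 0)),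
      ← lintegral_subtype_comap (measurableSet_singleton _).compl]
    refine lintegral_congr fun y => ?_
    rw [homeomorphUnitSphereProd_apply_fst_coe, ← homeomorphUnitSphereProd_apply_snd_coe]
    exact congrArg _ (if_congr Iff.rfl rfl rfl)
  rw [polar, lintegral_prod_mul (f := fun x : Metric.sphere (0 : E) 1 => f x) (by fun_prop)
    (measurable_one.indicator measurableSet_Iio).aemeasurable,
    lintegral_indicator_one measurableSet_Iio, radial_mass, mul_comm,
    ENNReal.inv_mul_cancel_right hrank (ENNReal.natCast_ne_top _)]

/-- Archimedes' hat-box theorem. -/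
theorem map_inner_toSphere (hE : Module.finrank ℝ E = 3) {u : E} (hu : ‖u‖ = 1) :
    (volume : Measure E).toSphere.map (fun x : Metric.sphere (0 : E) 1 => inner ℝ (x : E) u) =
      ENNReal.ofReal (2 * π) • volume.restrict (Ioo (-1) 1) := by
  have : Nontrivial E := Module.nontrivial_of_finrank_pos (R := ℝ) (by lia)
  refine Measure.ext_of_lintegral _ fun f hf => ?_
  let G (z r : ℝ) : ℝ≥0∞ := f (r⁻¹ * z) * (Iio (1 : ℝ)).indicator 1 r
  have hG : Measurable (Function.uncurry G) :=
    (hf.comp (by fun_prop)).mul ((measurable_one.indicator measurableSet_Iio).comp measurable_snd)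
  have shell : ∀ r ∈ Ioi (0 : ℝ), ENNReal.ofReal (r ^ 2) * ∫⁻ t in Ioo (-1) 1, G (r * t) r =
      (Iio 1).indicator (fun r => ENNReal.ofReal (r ^ 2)) r * ∫⁻ t in Ioo (-1) 1, f t := by
    intro r (hr : 0 < r)
    by_cases h1 : r < 1 <;> simp [G, h1, inv_mul_cancel_left₀ hr.ne']
  have radial_integral : ∫⁻ r in Ioi 0, (Iio 1).indicator (fun r => ENNReal.ofReal (r ^ 2)) r =
      ENNReal.ofReal (1 / 3) := by
    rw [setLIntegral_indicator measurableSet_Iio, inter_comm, Ioi_inter_Iio,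
      Measure.restrict_congr_set Ioo_ae_eq_Ioc, ← ofReal_integral_eq_lintegral_ofReal
      (intervalIntegral.intervalIntegrable_pow 2).1 (ae_of_all _ fun r => sq_nonneg r),
      ← intervalIntegral.integral_of_le zero_le_one, integral_pow]
    norm_num
  rw [lintegral_map hf (by fun_prop), lintegral_toSphere (f := fun x => f (inner ℝ x u))
    (by fun_prop), lintegral_smul_measure, smul_eq_mul]
  simp_rw [real_inner_smul_left]
  rw [lintegral_inner_norm hE hu hG, setLIntegral_congr_fun measurableSet_Ioi shell,
    lintegral_mul_const _ (.indicator (by fun_prop) measurableSet_Iio), radial_integral, hE]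
  calc ((3 : ℕ) : ℝ≥0∞) *
        (ENNReal.ofReal (2 * π) * (ENNReal.ofReal (1 / 3) * ∫⁻ t in Ioo (-1) 1, f t))
      = ENNReal.ofReal 3 * ENNReal.ofReal (1 / 3) *
          (ENNReal.ofReal (2 * π) * ∫⁻ t in Ioo (-1) 1, f t) := by
        rw [ENNReal.ofReal_ofNat]; push_cast; ring
    _ = ENNReal.ofReal (2 * π) * ∫⁻ t in Ioo (-1) 1, f t := by
        rw [← ENNReal.ofReal_mul (by norm_num)]; norm_num

end Archimedes

section SphereDistance

open Set ENNReal

theorem map_sub_mul_restrict_Ioo {p : ℝ} (hp : 0 < p) (q a b : ℝ) :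
    (volume.restrict (Ioo a b)).map (fun t => q - p * t) =
      ENNReal.ofReal p⁻¹ • volume.restrict (Ioo (q - p * b) (q - p * a)) := by
  have map_volume :
      (volume : Measure ℝ).map (fun t => q - p * t) = ENNReal.ofReal p⁻¹ • volume := by
    rw [← Function.comp_def (q - ·) (p * ·),
      ← Measure.map_map (measurable_const_sub q) (measurable_const_mul p),
      Real.map_volume_mul_left hp.ne', abs_of_pos (inv_pos.2 hp), Measure.map_smul,
      (Measure.measurePreserving_sub_left volume q).map_eq]
  have preimage_eq : (fun t => q - p * t) ⁻¹' Ioo (q - p * b) (q - p * a) = Ioo a b := by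
    ext t
    simp [hp, and_comm]
  rw [← preimage_eq, ← Measure.restrict_map (by fun_prop) measurableSet_Ioo, map_volume,
    Measure.restrict_smul]

theorem dist_smul_sq {E : Type*} [NormedAddCommGroup E] [InnerProductSpace ℝ E] {u : E}
    (hu : ‖u‖ = 1) (x : E) (d : ℝ) :
    dist x (d • u) ^ 2 = ‖x‖ ^ 2 + d ^ 2 - 2 * d * inner ℝ x u := by
  rw [dist_eq_norm, norm_sub_sq_real, norm_smul, hu, real_inner_smul_right, Real.norm_eq_abs,
    mul_one, sq_abs]
  ring

theorem ae_norm_sphereArea {R : ℝ} (hR : 0 ≤ R) : ∀ᵐ x ∂(Params.sphereArea R), ‖x‖ = R := by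
  refine Measure.ae_smul_measure ?_ _
  rw [ae_map_iff (by fun_prop) (measurableSet_eq_fun measurable_norm measurable_const)]
  exact ae_of_all _ fun x => by simp [norm_smul, abs_of_nonneg hR]

theorem map_dist_sq_sphereArea {u : Space} (hu : ‖u‖ = 1) {R d : ℝ} (hR : 0 < R) (hd : 0 < d) :
    (Params.sphereArea R).map (fun x => dist x (d • u) ^ 2) =
      ENNReal.ofReal (π * R / d) • volume.restrict (Ioc ((d - R) ^ 2) ((d + R) ^ 2)) := by
  have dist_sq_eq : (fun x : Space => dist x (d • u) ^ 2) ∘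
      (fun x : Metric.sphere (0 : Space) 1 => R • (x : Space)) =
        (fun t => R ^ 2 + d ^ 2 - 2 * d * R * t) ∘
          fun x : Metric.sphere (0 : Space) 1 => inner ℝ (x : Space) u := by
    ext x
    simp only [Function.comp_apply, dist_smul_sq hu, norm_smul, Real.norm_of_nonneg hR.le,
      norm_eq_of_mem_sphere, real_inner_smul_left, mul_one]
    ring
  have constant_eq : R ^ 2 * (2 * π) * (2 * d * R)⁻¹ = π * R / d := by field_simp
  rw [Params.sphereArea, Measure.map_smul, Measure.map_map (by fun_prop) (by fun_prop), dist_sq_eq,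
    ← Measure.map_map (by fun_prop) (by fun_prop), map_inner_toSphere (by simp) hu,
    Measure.map_smul, map_sub_mul_restrict_Ioo (by positivity), smul_smul, smul_smul,
    ← ENNReal.ofReal_mul (by positivity), ← ENNReal.ofReal_mul (by positivity), constant_eq,
    Measure.restrict_congr_set Ioo_ae_eq_Ioc]
  congr 3 <;> ring

instance isFiniteMeasure_sphereArea (R : ℝ) : IsFiniteMeasure (Params.sphereArea R) := by
  rw [Params.sphereArea]
  exact Measure.smul_finite _ ENNReal.ofReal_ne_top

end SphereDistance

section Beam

/-- The distance from a point at distance `d` from the origin to the first point of the sphere of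
radius `R` about the origin, along a ray at angle `b` from the direction of the origin. It is the
smaller root of `r ^ 2 - 2 * d * cos b * r + (d ^ 2 - R ^ 2)`, by the law of cosines. -/
noncomputable def firstHit (d R b : ℝ) : ℝ :=
  d * Real.cos b - √(R ^ 2 - d ^ 2 * Real.sin b ^ 2)

variable {d R b : ℝ}

theorem firstHit_le_add (hR : 0 ≤ R) (hd : 0 ≤ d) : firstHit d R b ≤ d + R := by
  have hcos : d * Real.cos b ≤ d := mul_le_of_le_one_right hd (Real.cos_le_one b)
  have hsqrt := Real.sqrt_nonneg (R ^ 2 - d ^ 2 * Real.sin b ^ 2)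
  rw [firstHit]
  linarith

theorem le_firstHit_iff (hR : 0 ≤ R) (hRd : R < d) (hb : 0 ≤ b) (hb' : b < π / 2)
    (hit : d * Real.sin b ≤ R) {r : ℝ} (hr : 0 < r) :
    r ≤ firstHit d R b ↔
      r ^ 2 ≤ d ^ 2 - R ^ 2 ∧ 2 * d * r * Real.cos b ≤ d ^ 2 - R ^ 2 + r ^ 2 := by
  have hd : 0 < d := hR.trans_lt hRd
  have hsin : 0 ≤ Real.sin b := Real.sin_nonneg_of_nonneg_of_le_pi hb (by linarith [Real.pi_pos])
  have hcos : 0 < Real.cos b := Real.cos_pos_of_mem_Ioo ⟨by linarith [Real.pi_pos], hb'⟩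
  have hdisc : 0 ≤ R ^ 2 - d ^ 2 * Real.sin b ^ 2 := by
    rw [← mul_pow]
    exact sub_nonneg.2 (pow_le_pow_left₀ (by positivity) hit 2)
  rw [firstHit]
  set q := √(R ^ 2 - d ^ 2 * Real.sin b ^ 2)
  have hq0 : 0 ≤ q := Real.sqrt_nonneg _
  have root_mul : (d * Real.cos b - q) * (d * Real.cos b + q) = d ^ 2 - R ^ 2 := by
    linear_combination d ^ 2 * Real.sin_sq_add_cos_sq b - Real.sq_sqrt hdisc
  have hpos : 0 < d * Real.cos b + q := by positivity
  have quadratic : d ^ 2 - R ^ 2 + r ^ 2 - 2 * d * r * Real.cos b =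
      (d * Real.cos b - q - r) * (d * Real.cos b + q - r) := by
    linear_combination -root_mul
  rw [← sub_nonneg (b := 2 * d * r * Real.cos b), quadratic, ← root_mul]
  constructor
  · intro h
    exact ⟨by nlinarith, mul_nonneg (by linarith) (by linarith)⟩
  · rintro ⟨hle, hprod⟩
    by_contra! h
    have : r < d * Real.cos b + q := by nlinarith
    nlinarith

theorem sub_le_firstHit (hR : 0 ≤ R) (hRd : R < d) (hb : 0 ≤ b) (hb' : b < π / 2)
    (hit : d * Real.sin b ≤ R) : d - R ≤ firstHit d R b := by
  have hd : 0 ≤ d := hR.trans hRd.le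
  have hcos : d * (d - R) * Real.cos b ≤ d * (d - R) :=
    mul_le_of_le_one_right (mul_nonneg hd (sub_nonneg.2 hRd.le)) (Real.cos_le_one b)
  rw [le_firstHit_iff hR hRd hb hb' hit (sub_pos.2 hRd)]
  constructor <;> nlinarith

end Beam

namespace Params

open Set

variable (S : Params)

theorem lamA_pos : 0 < S.lamA := by
  refine mul_pos S.lamA0_pos ?_
  rw [retain]
  split_ifs with h
  · exact one_pos
  · have hpos : 0 < S.lamA0 * π * S.dMin ^ 2 :=
      mul_pos (mul_pos S.lamA0_pos Real.pi_pos) (by positivity)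
    exact div_pos (sub_pos.2 (Real.exp_lt_one_iff.2 (neg_lt_zero.2 hpos))) hpos

theorem density_nonneg (i : Hop) : 0 ≤ S.density i := by
  cases i
  · exact mul_nonneg S.pT_nonneg S.lamU_nonneg
  · exact S.lamA_pos.le

theorem capHeight_pos : 0 < S.capHeight := by
  have := S.lamA_pos
  have := S.Re_pos
  rw [capHeight]
  positivity

theorem beam_pos : 0 < S.beam := by
  have := S.c_pos
  have := S.kappa_pos
  have := S.f_pos .second
  have := S.D_pos .second
  rw [beam]
  positivity

theorem txRadius_pos (i : Hop) : 0 < S.txRadius i := by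
  have := S.Re_pos
  have := S.Ha_pos
  cases i <;> simp only [txRadius] <;> linarith

theorem rxRadius_sub_txRadius (i : Hop) : S.rxRadius i - S.txRadius i = S.rMin i := by
  cases i <;> simp only [txRadius, rxRadius, rMin] <;> ring

theorem rMin_pos (i : Hop) : 0 < S.rMin i := by
  have := S.Ha_pos
  have := S.Ha_lt_Hs
  cases i <;> simp only [rMin] <;> linarith

theorem txRadius_lt_rxRadius (i : Hop) : S.txRadius i < S.rxRadius i :=
  sub_pos.1 ((S.rMin_pos i).trans_eq (S.rxRadius_sub_txRadius i).symm)

theorem rxRadius_pos (i : Hop) : 0 < S.rxRadius i :=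
  (S.txRadius_pos i).trans (S.txRadius_lt_rxRadius i)

theorem Rdot_eq (i : Hop) : S.Rdot i = S.density i * (π * S.txRadius i / S.rxRadius i) := by
  cases i <;> simp only [Rdot, txRadius, rxRadius] <;> ring

theorem Rdot_nonneg (i : Hop) : 0 ≤ S.Rdot i := by
  have := S.density_nonneg i
  have := S.txRadius_pos i
  have := S.rxRadius_pos i
  rw [Rdot_eq]
  positivity

theorem rMax_first_sq : S.rMax .first ^ 2 = S.Ha ^ 2 + 2 * S.capHeight * (S.Re + S.Ha) := by
  have := S.Ha_pos
  have := S.Re_pos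
  have := S.capHeight_pos
  exact Real.sq_sqrt (by positivity)

theorem rMax_second :
    S.rMax .second = firstHit (S.rxRadius .second) (S.txRadius .second) S.beam :=
  rfl

theorem rMin_le_rMax {i : Hop} (hcap : S.CapFits i) : S.rMin i ≤ S.rMax i := by
  cases i
  · have := S.Ha_pos
    have := S.Re_pos
    have := S.capHeight_pos
    exact Real.le_sqrt_of_sq_le (le_add_of_nonneg_right (by positivity))
  · rw [← S.rxRadius_sub_txRadius, rMax_second]
    exact sub_le_firstHit (S.txRadius_pos _).le (S.txRadius_lt_rxRadius _) S.beam_pos.le hcap.1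
      hcap.2

theorem rMin_sq_le_rMax_sq {i : Hop} (hcap : S.CapFits i) : S.rMin i ^ 2 ≤ S.rMax i ^ 2 :=
  pow_le_pow_left₀ (S.rMin_pos i).le (S.rMin_le_rMax hcap) 2

theorem rMax_pos {i : Hop} (hcap : S.CapFits i) : 0 < S.rMax i :=
  (S.rMin_pos i).trans_le (S.rMin_le_rMax hcap)

theorem rMax_sq_le {i : Hop} (hcap : S.CapFits i) :
    S.rMax i ^ 2 ≤ (S.rxRadius i + S.txRadius i) ^ 2 := by
  cases i
  · have hH : S.capHeight ≤ 2 * S.Re := hcap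
    have hD : 0 < S.Re + S.Ha := S.rxRadius_pos .first
    rw [rMax_first_sq, rxRadius, txRadius]
    nlinarith
  · have hle : S.rMax .second ≤ S.rxRadius .second + S.txRadius .second :=
      firstHit_le_add (S.txRadius_pos .second).le (S.rxRadius_pos .second).le
    exact pow_le_pow_left₀ (S.rMax_pos hcap).le hle 2

section Coverage

variable {u x : Space}

theorem norm_of_mem_coverage {i : Hop} (hx : x ∈ S.coverage i u) : ‖x‖ = S.txRadius i := by
  cases i <;> exact hx.1

theorem dist_receiver_pos (i : Hop) (hu : ‖u‖ = 1) (hx : ‖x‖ = S.txRadius i) :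
    0 < dist x (S.receiver i u) := by
  rw [dist_pos]
  rintro rfl
  rw [receiver, norm_smul, hu, mul_one, Real.norm_of_nonneg (S.rxRadius_pos i).le] at hx
  exact (S.txRadius_lt_rxRadius i).ne' hx

theorem mem_coverage_first_iff (hu : ‖u‖ = 1) (hx : ‖x‖ = S.txRadius .first) :
    x ∈ S.coverage .first u ↔ dist x (S.receiver .first u) ^ 2 ≤ S.rMax .first ^ 2 := by
  have hD : 0 < S.Re + S.Ha := S.rxRadius_pos .first
  have hdist := dist_smul_sq hu x (S.Re + S.Ha)
  have hx' : ‖x‖ = S.Re := hx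
  calc x ∈ S.coverage .first u ↔ S.Re - S.capHeight ≤ inner ℝ x u := and_iff_right hx
    _ ↔ 2 * (S.Re + S.Ha) * (S.Re - S.capHeight) ≤ 2 * (S.Re + S.Ha) * inner ℝ x u :=
      (mul_le_mul_iff_right₀ (by positivity)).symm
    _ ↔ dist x (S.receiver .first u) ^ 2 ≤ S.rMax .first ^ 2 := by
      rw [receiver, rxRadius, rMax_first_sq, hdist, hx']
      constructor <;> intro h <;> linarith

theorem angle_le_beam_iff (hcap : S.CapFits .second) (hu : ‖u‖ = 1)
    (hx : ‖x‖ = S.txRadius .second) :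
    InnerProductGeometry.angle (S.receiver .second u - x) u ≤ S.beam ↔
      2 * S.rxRadius .second * dist x (S.receiver .second u) * Real.cos S.beam ≤
        S.rxRadius .second ^ 2 - S.txRadius .second ^ 2 + dist x (S.receiver .second u) ^ 2 := by
  have hdist := dist_smul_sq hu x (S.rxRadius .second)
  have hpos := S.dist_receiver_pos .second hu hx
  have hD := S.rxRadius_pos .second
  have beam_le_pi : S.beam ≤ π := by linarith [hcap.1, Real.pi_pos]
  have cos_angle : Real.cos (InnerProductGeometry.angle (S.receiver .second u - x) u) =
      (S.rxRadius .second - inner ℝ x u) / dist x (S.receiver .second u) := by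
    rw [InnerProductGeometry.cos_angle, hu, mul_one, ← dist_eq_norm, dist_comm _ x,
      inner_sub_left, receiver, real_inner_smul_left, real_inner_self_eq_norm_sq, hu]
    norm_num
  rw [← Real.strictAntiOn_cos.le_iff_ge ⟨S.beam_pos.le, beam_le_pi⟩
    ⟨InnerProductGeometry.angle_nonneg _ _, InnerProductGeometry.angle_le_pi _ _⟩, cos_angle,
    le_div_iff₀ hpos, ← mul_le_mul_iff_right₀ (by positivity : 0 < 2 * S.rxRadius .second)]
  rw [hx] at hdist
  change dist x (S.receiver .second u) ^ 2 = _ at hdist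
  constructor <;> intro h <;> linarith

theorem mem_coverage_second_iff (hcap : S.CapFits .second) (hu : ‖u‖ = 1)
    (hx : ‖x‖ = S.txRadius .second) :
    x ∈ S.coverage .second u ↔ dist x (S.receiver .second u) ^ 2 ≤ S.rMax .second ^ 2 := by
  have hpos := S.dist_receiver_pos .second hu hx
  have hdist := dist_smul_sq hu x (S.rxRadius .second)
  have near_side_iff : S.txRadius .second ^ 2 ≤ S.rxRadius .second * inner ℝ x u ↔
      dist x (S.receiver .second u) ^ 2 ≤ S.rxRadius .second ^ 2 - S.txRadius .second ^ 2 := by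
    rw [receiver, hdist, hx]
    constructor <;> intro h <;> linarith
  rw [pow_le_pow_iff_left₀ hpos.le (S.rMax_pos hcap).le two_ne_zero]
  have beam_iff := le_firstHit_iff (S.txRadius_pos .second).le (S.txRadius_lt_rxRadius .second)
    S.beam_pos.le hcap.1 hcap.2 hpos
  rw [rMax_second, beam_iff, ← near_side_iff, ← S.angle_le_beam_iff hcap hu hx]
  exact and_iff_right hx

theorem mem_coverage_iff {i : Hop} (hcap : S.CapFits i) (hu : ‖u‖ = 1) (hx : ‖x‖ = S.txRadius i) :
    x ∈ S.coverage i u ↔ dist x (S.receiver i u) ^ 2 ≤ S.rMax i ^ 2 := by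
  cases i
  · exact S.mem_coverage_first_iff hu hx
  · exact S.mem_coverage_second_iff hcap hu hx

end Coverage

variable {i : Hop} {u : Space}

theorem map_dist_sq_intensity (hcap : S.CapFits i) (hu : ‖u‖ = 1) :
    (S.intensity i u).map (fun x => dist x (S.receiver i u) ^ 2) =
      ENNReal.ofReal (S.Rdot i) • volume.restrict (Ioc (S.rMin i ^ 2) (S.rMax i ^ 2)) := by
  have coverage_ae_eq : (S.coverage i u : Set Space) =ᵐ[sphereArea (S.txRadius i)]
      (fun x => dist x (S.receiver i u) ^ 2) ⁻¹' Iic (S.rMax i ^ 2) := by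
    filter_upwards [ae_norm_sphereArea (S.txRadius_pos i).le] with x hx
    exact propext (S.mem_coverage_iff hcap hu hx)
  rw [intensity, Measure.restrict_congr_set coverage_ae_eq, Measure.map_smul,
    ← Measure.restrict_map (by fun_prop) measurableSet_Iic]
  simp only [receiver]
  rw [map_dist_sq_sphereArea hu (S.txRadius_pos i) (S.rxRadius_pos i), Measure.restrict_smul,
    Measure.restrict_restrict measurableSet_Iic, inter_comm, Ioc_inter_Iic,
    min_eq_right (S.rMax_sq_le hcap), smul_smul, ← ENNReal.ofReal_mul (S.density_nonneg i),
    rxRadius_sub_txRadius, Rdot_eq]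

instance isFiniteMeasure_intensity (i : Hop) (u : Space) : IsFiniteMeasure (S.intensity i u) := by
  rw [intensity]
  exact Measure.smul_finite _ ENNReal.ofReal_ne_top

theorem integral_intensity (hcap : S.CapFits i) (hu : ‖u‖ = 1) {f : ℝ → ℝ} (hf : Measurable f) :
    ∫ x, f (dist x (S.receiver i u) ^ 2) ∂(S.intensity i u) =
      S.Rdot i * ∫ y in (S.rMin i ^ 2)..(S.rMax i ^ 2), f y := by
  rw [← integral_map (φ := fun x => dist x (S.receiver i u) ^ 2) (by fun_prop)
    hf.aestronglyMeasurable, S.map_dist_sq_intensity hcap hu,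
    integral_smul_measure, ENNReal.toReal_ofReal (S.Rdot_nonneg i),
    ← intervalIntegral.integral_of_le (S.rMin_sq_le_rMax_sq hcap), smul_eq_mul]

end Params

section Independence

variable {Ω α β γ : Type*} [MeasurableSpace Ω] [MeasurableSpace α] [MeasurableSpace β]
  [MeasurableSpace γ] {μ : Measure Ω}

theorem indepFun_prodMk_right [IsFiniteMeasure μ] {A : Ω → α} {B : Ω → β} {C : Ω → γ}
    (hA : Measurable A) (hB : Measurable B) (hC : Measurable C) (hAB : IndepFun A B μ)
    (hABC : IndepFun (fun ω => (A ω, B ω)) C μ) : IndepFun A (fun ω => (B ω, C ω)) μ := by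
  have hBC : IndepFun B C μ := hABC.comp measurable_snd measurable_id
  rw [indepFun_iff_map_prod_eq_prod_map_map (by fun_prop) (by fun_prop)] at hAB hABC hBC ⊢
  rw [hBC, ← Measure.prodAssoc_prod, ← hAB, ← hABC,
    Measure.map_map MeasurableEquiv.prodAssoc.measurable (by fun_prop)]
  rfl

theorem indepFun_zero_succ [IsProbabilityMeasure μ] {g : ℕ → Ω → α} (hg : ∀ n, Measurable (g n))
    (hind : iIndepFun g μ) : IndepFun (g 0) (fun ω n => g (n + 1) ω) μ := by
  refine IndepFun.indepFun_process (hg 0) (fun n => hg (n + 1)) fun I => ?_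
  have disjoint_succ : Disjoint {0} (I.map (addRightEmbedding 1)) := by simp
  have indep := hind.indepFun_finset _ _ disjoint_succ hg
  exact indep.comp (measurable_pi_apply ⟨0, Finset.mem_singleton_self 0⟩)
    (measurable_pi_lambda (fun v (k : I) =>
      v ⟨k + 1, Finset.mem_map_of_mem (addRightEmbedding 1) k.2⟩) fun _ => measurable_pi_apply _)

theorem integral_comp_prodMk_of_indepFun [IsFiniteMeasure μ] {A : Ω → α} {B : Ω → β}
    (hA : Measurable A) (hB : Measurable B) (hAB : IndepFun A B μ) {f : α × β → ℝ}
    (hf : Measurable f) (hint : Integrable (fun ω => f (A ω, B ω)) μ) :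
    ∫ ω, f (A ω, B ω) ∂μ = ∫ ω, ∫ ω', f (A ω, B ω') ∂μ ∂μ := by
  have map_eq_prod :=
    (indepFun_iff_map_prod_eq_prod_map_map hA.aemeasurable hB.aemeasurable).1 hAB
  have integrable_prod : Integrable f ((μ.map A).prod (μ.map B)) :=
    map_eq_prod ▸ (integrable_map_measure hf.aestronglyMeasurable (by fun_prop)).2 hint
  calc ∫ ω, f (A ω, B ω) ∂μ
      = ∫ p, f p ∂(μ.map A).prod (μ.map B) := by
        rw [← map_eq_prod, integral_map (by fun_prop) hf.aestronglyMeasurable]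
    _ = ∫ ω, ∫ b, f (A ω, b) ∂μ.map B ∂μ := by
        rw [integral_prod _ integrable_prod, integral_map hA.aemeasurable
          hf.stronglyMeasurable.integral_prod_right'.aestronglyMeasurable]
    _ = ∫ ω, ∫ ω', f (A ω, B ω') ∂μ ∂μ := by
        congr with ω
        exact integral_map hB.aemeasurable (hf.comp measurable_prodMk_left).aestronglyMeasurable

theorem condExp_comp_prodMk_of_indepFun [IsFiniteMeasure μ] [StandardBorelSpace β] [Nonempty β]
    {A : Ω → α} {B : Ω → β} (hA : Measurable A) (hB : Measurable B) (hAB : IndepFun A B μ)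
    {f : α × β → ℝ} (hf : Measurable f) (hint : Integrable (fun ω => f (A ω, B ω)) μ) :
    μ[fun ω => f (A ω, B ω) | MeasurableSpace.comap A inferInstance] =ᵐ[μ]
      fun ω => ∫ ω', f (A ω, B ω') ∂μ := by
  have condDistrib_eq : condDistrib B A μ =ᵐ[μ.map A] Kernel.const α (μ.map B) :=
    condDistrib_ae_eq_of_measure_eq_compProd A hB.aemeasurable <| by
      rw [Measure.compProd_const,
        (indepFun_iff_map_prod_eq_prod_map_map hA.aemeasurable hB.aemeasurable).1 hAB]
  filter_upwards [condExp_prod_ae_eq_integral_condDistrib hA hB.aemeasurable hf.stronglyMeasurable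
    hint, ae_of_ae_map hA.aemeasurable condDistrib_eq] with ω condExp_eq condDistrib_eq
  rw [condExp_eq, condDistrib_eq, Kernel.const_apply]
  exact integral_map hB.aemeasurable (hf.comp measurable_prodMk_left).aestronglyMeasurable

theorem integral_prod_range_of_iIndepFun {g : ℕ → Ω → α} (hg : ∀ k, Measurable (g k))
    (hind : iIndepFun g μ) {φ : ℕ → α → ℝ} (hφ : ∀ k, Measurable (φ k)) (n : ℕ) :
    ∫ ω, ∏ k ∈ Finset.range n, φ k (g k ω) ∂μ =
      ∏ k ∈ Finset.range n, ∫ y, φ k y ∂μ.map (g k) := by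
  simp_rw [Finset.prod_range,
    integral_map (hg _).aemeasurable (hφ _).aestronglyMeasurable]
  exact (hind.precomp Fin.val_injective).integral_fun_prod_comp
    (fun k => (hg k).aemeasurable) fun k => (hφ k).aestronglyMeasurable

@[to_additive]
theorem measurable_prod_range_marked {M : Type*} [CommMonoid M] [MeasurableSpace M]
    [MeasurableMul₂ M] {f : α × γ → M} (hf : Measurable f) :
    Measurable fun p : (ℕ × (ℕ → α)) × (ℕ → γ) =>
      ∏ k ∈ Finset.range p.1.1, f (p.1.2 k, p.2 k) := by
  have measurable_uncurry : Measurable fun q : ℕ × (ℕ → α) × (ℕ → γ) =>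
      ∏ k ∈ Finset.range q.1, f (q.2.1 k, q.2.2 k) :=
    measurable_from_prod_countable_right fun n =>
      Finset.measurable_fun_prod (Finset.range n) fun k _ =>
        hf.comp (f := fun q : (ℕ → α) × (ℕ → γ) => (q.1 k, q.2 k)) (by fun_prop)
  exact measurable_uncurry.comp MeasurableEquiv.prodAssoc.measurable

end Independence

section PoissonProcess

open Set Filter Topology

theorem integral_pow_poissonMeasure (r : NNReal) (c : ℝ) :
    ∫ n, c ^ n ∂(poissonMeasure r) = Real.exp (-((r : ℝ) * (1 - c))) := by
  have hasSum_exp := (NormedSpace.expSeries_div_hasSum_exp ((r : ℝ) * c)).mul_left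
    (Real.exp (-(r : ℝ)))
  rw [← Real.exp_eq_exp_ℝ, ← Real.exp_add] at hasSum_exp
  rw [integral_poissonMeasure, show -((r : ℝ) * (1 - c)) = -r + r * c by ring,
    ← hasSum_exp.tsum_eq]
  refine tsum_congr fun n => ?_
  rw [smul_eq_mul, mul_pow]
  ring

theorem prod_eq_prod_pow_count (φ : SimpleFunc Space ℝ) (n : ℕ) (x : ℕ → Space) :
    ∏ k ∈ Finset.range n, φ (x k) = ∏ c ∈ φ.range, c ^ count n x (φ ⁻¹' {c}) := by
  classical
  rw [← Finset.prod_fiberwise_of_maps_to' (t := φ.range) (g := fun k => φ (x k))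
    (fun k _ => φ.mem_range_self _) (fun c => c)]
  refine Finset.prod_congr rfl fun c _ => ?_
  rw [Finset.prod_const]
  unfold count
  congr 2

theorem integral_comp_simpleFunc {α : Type*} [MeasurableSpace α] (Λ : Measure α)
    [IsFiniteMeasure Λ] (φ : SimpleFunc α ℝ) (f : ℝ → ℝ) :
    ∫ x, f (φ x) ∂Λ = ∑ c ∈ φ.range, Λ.real (φ ⁻¹' {c}) * f c := by
  have preimage_cover : ⋃ c ∈ φ.range, φ ⁻¹' {c} = univ :=
    eq_univ_of_forall fun x => mem_iUnion₂.2 ⟨φ x, φ.mem_range_self x, rfl⟩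
  have integrable_comp : Integrable (fun x => f (φ x)) Λ :=
    (φ.map f).integrable_of_isFiniteMeasure
  rw [← setIntegral_univ, ← preimage_cover, integral_biUnion_finset _
    (fun c _ => φ.measurableSet_preimage {c})
    (fun c _ c' _ hc => Disjoint.preimage _ (disjoint_singleton.2 hc))
    fun c _ => integrable_comp.integrableOn]
  refine Finset.sum_congr rfl fun c _ => ?_
  rw [setIntegral_congr_fun (φ.measurableSet_preimage {c})
    (fun x hx => congrArg f (mem_singleton_iff.1 hx)), setIntegral_const, smul_eq_mul]

namespace IsPoissonProcess

variable {Ω : Type*} [MeasurableSpace Ω] {μ : Measure Ω} {Λ : Measure Space} {N : Ω → ℕ}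
  {X : ℕ → Ω → Space}

theorem measurable_enumeration (h : IsPoissonProcess μ Λ N X) :
    Measurable fun ω => (N ω, fun n => X n ω) :=
  h.measurable_card.prodMk (measurable_pi_lambda _ h.measurable_point)

theorem aemeasurable_count (h : IsPoissonProcess μ Λ N X) {B : Set Space} (hB : MeasurableSet B) :
    AEMeasurable (fun ω => count (N ω) (fun n => X n ω) B) μ := by
  refine aemeasurable_of_map_neZero ?_
  rw [h.law_count B hB]
  infer_instance

theorem integral_pow_count (h : IsPoissonProcess μ Λ N X) {B : Set Space} (hB : MeasurableSet B)
    (c : ℝ) :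
    ∫ ω, c ^ count (N ω) (fun n => X n ω) B ∂μ = Real.exp (-(Λ.real B * (1 - c))) := by
  rw [← integral_map (h.aemeasurable_count hB) (f := fun n : ℕ => c ^ n)
    (measurable_of_countable _).aestronglyMeasurable, h.law_count B hB,
    integral_pow_poissonMeasure]
  rfl

theorem integral_prod_pow_count (h : IsPoissonProcess μ Λ N X) (φ : SimpleFunc Space ℝ) :
    ∫ ω, ∏ c ∈ φ.range, c ^ count (N ω) (fun n => X n ω) (φ ⁻¹' {c}) ∂μ =
      ∏ c ∈ φ.range, Real.exp (-(Λ.real (φ ⁻¹' {c}) * (1 - c))) := by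
  set e := φ.range.equivFin.symm
  have prod_equivFin (f : ℝ → ℝ) : ∏ c ∈ φ.range, f c = ∏ j, f (e j) := by
    rw [← Finset.prod_coe_sort, ← e.prod_comp]
  have levelSets_disjoint :
      Pairwise fun j j' => Disjoint (φ ⁻¹' {(e j : ℝ)}) (φ ⁻¹' {(e j' : ℝ)}) := fun j j' hj =>
    Disjoint.preimage _ (disjoint_singleton.2 fun h' => hj (e.injective (Subtype.ext h')))
  have counts_indep :=
    h.indep_count _ _ (fun j => φ.measurableSet_preimage {(e j : ℝ)}) levelSets_disjoint
  simp_rw [prod_equivFin]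
  rw [counts_indep.integral_fun_prod_comp (f := fun j n => (e j : ℝ) ^ n)
    (fun j => h.aemeasurable_count (φ.measurableSet_preimage _))
    fun j => (measurable_of_countable _).aestronglyMeasurable]
  simp_rw [h.integral_pow_count (φ.measurableSet_preimage _)]

theorem integral_prod_simpleFunc [IsFiniteMeasure Λ] (h : IsPoissonProcess μ Λ N X)
    (φ : SimpleFunc Space ℝ) :
    ∫ ω, ∏ k ∈ Finset.range (N ω), φ (X k ω) ∂μ = Real.exp (-∫ x, (1 - φ x) ∂Λ) := by
  simp_rw [fun ω => prod_eq_prod_pow_count φ (N ω) (fun n => X n ω)]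
  rw [h.integral_prod_pow_count, ← Real.exp_sum, Finset.sum_neg_distrib,
    integral_comp_simpleFunc Λ φ (1 - ·)]

theorem measurable_prod (h : IsPoissonProcess μ Λ N X) {φ : Space → ℝ} (hφ : Measurable φ) :
    Measurable fun ω => ∏ k ∈ Finset.range (N ω), φ (X k ω) :=
  (measurable_prod_range_marked (hφ.comp measurable_fst)).comp
    (h.measurable_enumeration.prodMk (measurable_pi_lambda _ h.measurable_point))

theorem integral_prod [IsFiniteMeasure μ] [IsFiniteMeasure Λ] (h : IsPoissonProcess μ Λ N X)
    {φ : Space → ℝ} (hφ : Measurable φ) (hφ01 : ∀ x, φ x ∈ Icc (0 : ℝ) 1) :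
    ∫ ω, ∏ k ∈ Finset.range (N ω), φ (X k ω) ∂μ = Real.exp (-∫ x, (1 - φ x) ∂Λ) := by
  have zero_mem : (0 : ℝ) ∈ Icc (0 : ℝ) 1 := by simp
  set ψ : ℕ → SimpleFunc Space ℝ := SimpleFunc.approxOn φ hφ (Icc 0 1) 0 zero_mem
  have ψ_mem n x : ψ n x ∈ Icc (0 : ℝ) 1 := SimpleFunc.approxOn_mem hφ zero_mem n x
  have tendsto_ψ x : Tendsto (fun n => ψ n x) atTop (𝓝 (φ x)) :=
    SimpleFunc.tendsto_approxOn hφ zero_mem (subset_closure (hφ01 x))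
  have tendsto_integral_prod :
      Tendsto (fun n => ∫ ω, ∏ k ∈ Finset.range (N ω), ψ n (X k ω) ∂μ) atTop
        (𝓝 (∫ ω, ∏ k ∈ Finset.range (N ω), φ (X k ω) ∂μ)) := by
    refine tendsto_integral_of_dominated_convergence (fun _ => 1)
      (fun n => (h.measurable_prod (ψ n).measurable).aestronglyMeasurable) (integrable_const 1)
      (fun n => ae_of_all _ fun ω => ?_)
      (ae_of_all _ fun ω => tendsto_finsetProd _ fun k _ => tendsto_ψ _)
    rw [Real.norm_of_nonneg (Finset.prod_nonneg fun k _ => (ψ_mem n _).1)]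
    exact Finset.prod_le_one (fun k _ => (ψ_mem n _).1) fun k _ => (ψ_mem n _).2
  have tendsto_integral_sub :
      Tendsto (fun n => ∫ x, (1 - ψ n x) ∂Λ) atTop (𝓝 (∫ x, (1 - φ x) ∂Λ)) := by
    refine tendsto_integral_of_dominated_convergence (fun _ => 1)
      (fun n => (measurable_const.sub (ψ n).measurable).aestronglyMeasurable) (integrable_const 1)
      (fun n => ae_of_all _ fun x => ?_) (ae_of_all _ fun x => (tendsto_ψ x).const_sub 1)
    rw [Real.norm_of_nonneg (sub_nonneg.2 (ψ_mem n x).2)]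
    exact sub_le_self 1 (ψ_mem n x).1
  simp_rw [h.integral_prod_simpleFunc] at tendsto_integral_prod
  exact tendsto_nhds_unique tendsto_integral_prod
    ((Real.continuous_exp.tendsto _).comp tendsto_integral_sub.neg)

theorem integral_prod_marked [IsProbabilityMeasure μ] [IsFiniteMeasure Λ]
    (h : IsPoissonProcess μ Λ N X) {γ : Type*} [MeasurableSpace γ] {L : Measure γ}
    {G : ℕ → Ω → γ} (hG : ∀ n, Measurable (G n)) (hlaw : ∀ n, μ.map (G n) = L)
    (hind : iIndepFun G μ) (hXG : IndepFun (fun ω => (N ω, fun n => X n ω)) (fun ω n => G n ω) μ)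
    {F : Space × γ → ℝ} (hF : Measurable F) (hF01 : ∀ p, F p ∈ Icc (0 : ℝ) 1) :
    ∫ ω, ∏ k ∈ Finset.range (N ω), F (X k ω, G k ω) ∂μ =
      Real.exp (-∫ x, (1 - ∫ y, F (x, y) ∂L) ∂Λ) := by
  have : IsProbabilityMeasure L := hlaw 0 ▸ Measure.isProbabilityMeasure_map (hG 0).aemeasurable
  have measurable_marks : Measurable fun ω n => G n ω := measurable_pi_lambda _ hG
  have measurable_prod := measurable_prod_range_marked hF
  have integrable_prod : Integrable (fun ω => ∏ k ∈ Finset.range (N ω), F (X k ω, G k ω)) μ := by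
    refine Integrable.of_bound (C := 1) (measurable_prod.comp
      (h.measurable_enumeration.prodMk measurable_marks)).aestronglyMeasurable
      (ae_of_all _ fun ω => ?_)
    rw [Real.norm_of_nonneg (Finset.prod_nonneg fun k _ => (hF01 _).1)]
    exact Finset.prod_le_one (fun k _ => (hF01 _).1) fun k _ => (hF01 _).2
  have integral_marks_mem x : ∫ y, F (x, y) ∂L ∈ Icc (0 : ℝ) 1 := by
    refine ⟨integral_nonneg fun y => (hF01 _).1, ?_⟩
    simpa using integral_mono_of_nonneg (μ := L) (ae_of_all _ fun y => (hF01 (x, y)).1)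
      (integrable_const 1) (ae_of_all _ fun y => (hF01 (x, y)).2)
  calc ∫ ω, ∏ k ∈ Finset.range (N ω), F (X k ω, G k ω) ∂μ
      = ∫ ω, ∫ ω', ∏ k ∈ Finset.range (N ω), F (X k ω, G k ω') ∂μ ∂μ :=
        integral_comp_prodMk_of_indepFun h.measurable_enumeration measurable_marks hXG
          measurable_prod integrable_prod
    _ = ∫ ω, ∏ k ∈ Finset.range (N ω), ∫ y, F (X k ω, y) ∂L ∂μ := by
        congr with ω
        rw [integral_prod_range_of_iIndepFun hG hind (φ := fun k y => F (X k ω, y))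
          fun k => hF.comp measurable_prodMk_left]
        simp only [hlaw]
    _ = Real.exp (-∫ x, (1 - ∫ y, F (x, y) ∂L) ∂Λ) :=
        h.integral_prod hF.stronglyMeasurable.integral_prod_right'.measurable integral_marks_mem

end IsPoissonProcess

end PoissonProcess

section Gamma

open Set Filter Topology

variable {r : ℝ}

theorem integral_gammaMeasure {a : ℝ} (ha : 0 < a) (hr : 0 < r) (f : ℝ → ℝ) :
    ∫ x, f x ∂gammaMeasure a r = ∫ x in Ioi 0, gammaPDFReal a r x * f x := by
  have measurable_pdf : Measurable (gammaPDF a r) := (measurable_gammaPDFReal a r).ennreal_ofReal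
  rw [gammaMeasure, integral_withDensity_eq_integral_toReal_smul measurable_pdf
    (ae_of_all _ fun x => ENNReal.ofReal_lt_top), ← integral_Ici_eq_integral_Ioi,
    setIntegral_eq_integral_of_forall_compl_eq_zero fun x hx => by
      simp [gammaPDFReal, notMem_Ici.1 hx]]
  congr with x
  rw [gammaPDF, ENNReal.toReal_ofReal (gammaPDFReal_nonneg ha hr x), smul_eq_mul]

theorem ae_nonneg_gammaMeasure (a r : ℝ) : ∀ᵐ x ∂gammaMeasure a r, 0 ≤ x := by
  suffices gammaMeasure a r (Iio 0) = 0 by simpa only [ae_iff, not_le]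
  rw [gammaMeasure, withDensity_apply _ measurableSet_Iio]
  exact lintegral_gammaPDF_of_nonpos le_rfl

theorem integral_exp_neg_mul_gammaMeasure {a t : ℝ} (ha : 0 < a) (hr : 0 < r) (ht : 0 < r + t) :
    ∫ x, Real.exp (-(t * x)) ∂gammaMeasure a r = (r / (r + t)) ^ a := by
  have pdf_mul_exp : ∀ x ∈ Ioi (0 : ℝ), gammaPDFReal a r x * Real.exp (-(t * x)) =
      r ^ a / Real.Gamma a * (x ^ (a - 1) * Real.exp (-((r + t) * x))) := fun x hx => by
    rw [gammaPDFReal, if_pos (mem_Ioi.1 hx).le, add_mul, neg_add, Real.exp_add]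
    ring
  rw [integral_gammaMeasure ha hr, setIntegral_congr_fun measurableSet_Ioi pdf_mul_exp,
    integral_const_mul, Real.integral_rpow_mul_exp_neg_mul_Ioi ha ht,
    Real.div_rpow hr.le ht.le, Real.div_rpow zero_le_one ht.le, Real.one_rpow]
  have := (Real.Gamma_pos_of_pos ha).ne'
  field_simp

theorem integral_exp_neg_mul_mul_gammaMeasure {m : ℕ} (hm : 0 < m) (hr : 0 < r) {t : ℝ}
    (ht : 0 ≤ t) : ∫ x, Real.exp (-(t * (r * x))) ∂gammaMeasure m r = ((1 + t) ^ m)⁻¹ := by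
  simp_rw [← mul_assoc]
  rw [integral_exp_neg_mul_gammaMeasure (Nat.cast_pos.2 hm) hr (by positivity), Real.rpow_natCast,
    ← one_add_mul, div_mul_cancel_right₀ hr.ne', inv_pow]

theorem hasDerivAt_neg_exp_neg_mul_sum (n : ℕ) (t : ℝ) :
    HasDerivAt (fun t : ℝ => -∑ k ∈ Finset.range (n + 1), Real.exp (-t) * t ^ k / k.factorial)
      (Real.exp (-t) * t ^ n / n.factorial) t := by
  have hasDerivAt_exp_neg : HasDerivAt (fun t : ℝ => Real.exp (-t)) (-Real.exp (-t)) t := by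
    simpa using (hasDerivAt_neg' t).exp
  induction n with
  | zero => simpa using hasDerivAt_exp_neg.fun_neg
  | succ n ih =>
    have hasDerivAt_term := (hasDerivAt_exp_neg.fun_mul (hasDerivAt_pow (n + 1) t)).div_const
      ((n + 1).factorial : ℝ)
    simp_rw [Finset.sum_range_succ _ (n + 1), neg_add]
    refine (ih.fun_add hasDerivAt_term.fun_neg).congr_deriv ?_
    rw [Nat.factorial_succ, Nat.add_sub_cancel]
    push_cast
    field

theorem measureReal_gammaMeasure_Ioi {m : ℕ} (hm : 0 < m) (hr : 0 < r) {x : ℝ} (hx : 0 ≤ x) :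
    (gammaMeasure m r).real (Ioi x) =
      ∑ k ∈ Finset.range m, Real.exp (-(r * x)) * (r * x) ^ k / k.factorial := by
  obtain ⟨n, rfl⟩ := Nat.exists_eq_add_one.2 hm
  set Q : ℝ → ℝ := fun t => ∑ k ∈ Finset.range (n + 1), Real.exp (-t) * t ^ k / k.factorial
  have hasDerivAt_Q (t : ℝ) (ht : t ∈ Ici x) :
      HasDerivAt (fun t => -Q (r * t)) (gammaPDFReal (n + 1 : ℕ) r t) t := by
    refine ((hasDerivAt_neg_exp_neg_mul_sum n (r * t)).comp t
      ((hasDerivAt_id' t).const_mul r)).congr_deriv ?_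
    rw [gammaPDFReal, if_pos (hx.trans ht), Nat.cast_succ, Real.Gamma_nat_eq_factorial,
      add_sub_cancel_right, Real.rpow_natCast, ← Nat.cast_succ, Real.rpow_natCast, pow_succ r]
    ring
  have tendsto_Q : Tendsto Q atTop (𝓝 0) := by
    have tendsto_term (k : ℕ) :
        Tendsto (fun t : ℝ => Real.exp (-t) * t ^ k / k.factorial) atTop (𝓝 0) := by
      simpa [mul_comm] using
        (Real.tendsto_pow_mul_exp_neg_atTop_nhds_zero k).div_const (k.factorial : ℝ)
    simpa using tendsto_finsetSum (Finset.range (n + 1)) fun k _ => tendsto_term k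
  have integral_pdf := integral_Ioi_of_hasDerivAt_of_nonneg' hasDerivAt_Q
    (fun t _ => gammaPDFReal_nonneg (by positivity) hr t)
    (by simpa using (tendsto_Q.comp (tendsto_id.const_mul_atTop hr)).neg)
  calc (gammaMeasure (n + 1 : ℕ) r).real (Ioi x)
      = ∫ t in Ioi 0, (Ioi x).indicator (gammaPDFReal (n + 1 : ℕ) r) t := by
        rw [← integral_indicator_one measurableSet_Ioi,
          integral_gammaMeasure (by positivity) hr]
        simp_rw [← indicator_mul_right, Pi.one_apply, mul_one]
    _ = ∫ t in Ioi x, gammaPDFReal (n + 1 : ℕ) r t := by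
        rw [setIntegral_indicator measurableSet_Ioi, inter_eq_right.2 (Ioi_subset_Ioi hx)]
    _ = Q (r * x) := by rw [integral_pdf]; ring

theorem exp_neg_mul_pow_div_factorial_le_one {y : ℝ} (hy : 0 ≤ y) (k : ℕ) :
    Real.exp (-y) * y ^ k / k.factorial ≤ 1 := by
  calc Real.exp (-y) * y ^ k / k.factorial
      = Real.exp (-y) * (y ^ k / k.factorial) := mul_div_assoc _ _ _
    _ ≤ Real.exp (-y) * Real.exp y := by gcongr; exact Real.pow_div_factorial_le_exp y hy k
    _ = 1 := by rw [← Real.exp_add, neg_add_cancel, Real.exp_zero]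

theorem integrable_exp_neg_mul_pow_div_factorial {Ω : Type*} [MeasurableSpace Ω] {μ : Measure Ω}
    [IsFiniteMeasure μ] {Y : Ω → ℝ} (hY : Measurable Y) (hY0 : ∀ᵐ ω ∂μ, 0 ≤ Y ω) (k : ℕ) :
    Integrable (fun ω => Real.exp (-Y ω) * Y ω ^ k / k.factorial) μ := by
  refine Integrable.of_bound (C := 1) (by fun_prop) ?_
  filter_upwards [hY0] with ω hω
  rw [Real.norm_of_nonneg (by positivity)]
  exact exp_neg_mul_pow_div_factorial_le_one hω k

theorem measureReal_lt_mul_of_map_eq_gammaMeasure {Ω : Type*} [MeasurableSpace Ω] {μ : Measure Ω}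
    [IsFiniteMeasure μ] {G Y : Ω → ℝ} {m : ℕ} (hG : Measurable G) (hY : Measurable Y)
    (hY0 : ∀ᵐ ω ∂μ, 0 ≤ Y ω) (hind : IndepFun Y G μ) (hm : 0 < m) (hr : 0 < r)
    (hlaw : μ.map G = gammaMeasure m r) :
    μ.real {ω | Y ω < r * G ω} =
      ∑ k ∈ Finset.range m, ∫ ω, Real.exp (-Y ω) * Y ω ^ k / k.factorial ∂μ := by
  set A : Set (ℝ × ℝ) := {p | p.1 < r * p.2}
  have measurableSet_A : MeasurableSet A := measurableSet_lt (by fun_prop) (by fun_prop)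
  have measurable_YG : Measurable fun ω => (Y ω, G ω) := hY.prodMk hG
  calc μ.real {ω | Y ω < r * G ω}
      = ∫ ω, A.indicator (1 : ℝ × ℝ → ℝ) (Y ω, G ω) ∂μ :=
        (integral_indicator_one (measurable_YG measurableSet_A)).symm
    _ = ∫ ω, ∫ ω', A.indicator (1 : ℝ × ℝ → ℝ) (Y ω, G ω') ∂μ ∂μ :=
        integral_comp_prodMk_of_indepFun hY hG hind (measurable_one.indicator measurableSet_A)
          ((integrable_const (1 : ℝ)).indicator (measurable_YG measurableSet_A))
    _ = ∫ ω, (gammaMeasure m r).real (Ioi (Y ω / r)) ∂μ := by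
        congr with ω
        have preimage_A : {ω' | (Y ω, G ω') ∈ A} = G ⁻¹' Ioi (Y ω / r) := by
          ext ω'
          simp [A, div_lt_iff₀' hr]
        rw [← hlaw, map_measureReal_apply hG measurableSet_Ioi, ← preimage_A]
        exact integral_indicator_one (measurable_prodMk_left.comp hG measurableSet_A)
    _ = ∫ ω, ∑ k ∈ Finset.range m, Real.exp (-Y ω) * Y ω ^ k / k.factorial ∂μ := by
        refine integral_congr_ae ?_
        filter_upwards [hY0] with ω hω
        rw [measureReal_gammaMeasure_Ioi hm hr (div_nonneg hω hr.le), mul_div_cancel₀ _ hr.ne']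
    _ = _ := integral_finsetSum _ fun k _ => integrable_exp_neg_mul_pow_div_factorial hY hY0 k

end Gamma

section Expansion

open Asymptotics Filter Topology Polynomial

/-- `P` is an expansion of `f` at `0` from the right, up to an error of order `n`. -/
def HasExpansion (n : ℕ) (f : ℝ → ℝ) (P : ℝ[X]) : Prop :=
  (fun w => f w - P.eval w) =O[𝓝[>] 0] fun w => w ^ n

theorem tendsto_eval_nhdsGT (P : ℝ[X]) (a : ℝ) :
    Tendsto (fun w => P.eval w) (𝓝[>] a) (𝓝 (P.eval a)) :=
  (P.continuous.tendsto a).mono_left nhdsWithin_le_nhds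

theorem tendsto_pow_nhdsGT_zero {n : ℕ} (hn : n ≠ 0) :
    Tendsto (fun w : ℝ => w ^ n) (𝓝[>] 0) (𝓝 0) := by
  simpa [hn] using tendsto_eval_nhdsGT (X ^ n) 0

theorem isBigO_pow_nhdsGT_zero_of_le {m n : ℕ} (h : n ≤ m) :
    (fun w : ℝ => w ^ m) =O[𝓝[>] 0] fun w => w ^ n := by
  refine IsBigO.of_norm_eventuallyLE ?_
  filter_upwards [Ioc_mem_nhdsGT one_pos] with w hw
  rw [Real.norm_of_nonneg (pow_nonneg hw.1.le m)]
  exact pow_le_pow_of_le_one hw.1.le hw.2 h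

theorem X_pow_dvd_of_isBigO {n : ℕ} {P : ℝ[X]}
    (hP : (fun w => P.eval w) =O[𝓝[>] 0] fun w => w ^ n) : X ^ n ∣ P := by
  induction n generalizing P with
  | zero => simp
  | succ n ih =>
    have eval_zero : P.eval 0 = 0 :=
      tendsto_nhds_unique (tendsto_eval_nhdsGT P 0)
        (hP.trans_tendsto (tendsto_pow_nhdsGT_zero n.succ_ne_zero))
    obtain ⟨Q, rfl⟩ := X_dvd_iff.2 ((coeff_zero_eq_eval_zero P).trans eval_zero)
    rw [pow_succ']
    refine mul_dvd_mul_left X (ih ?_)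
    refine ((isBigO_refl (fun w : ℝ => w⁻¹) (𝓝[>] 0)).mul hP).congr' ?_ ?_ <;>
    · filter_upwards [self_mem_nhdsWithin] with w (hw : 0 < w)
      simp [pow_succ', hw.ne']

namespace HasExpansion

variable {n : ℕ} {f g : ℝ → ℝ} {P Q : ℝ[X]}

theorem coeff_eq (hP : HasExpansion n f P) (hQ : HasExpansion n f Q) {k : ℕ} (hk : k < n) :
    P.coeff k = Q.coeff k := by
  have hdvd : X ^ n ∣ P - Q := X_pow_dvd_of_isBigO <|
    (hQ.sub hP).congr_left fun w => by rw [eval_sub]; ring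
  simpa [sub_eq_zero] using X_pow_dvd_iff.1 hdvd k hk

theorem isBigO_one (hP : HasExpansion n f P) : f =O[𝓝[>] 0] fun _ => (1 : ℝ) := by
  have hsub : (fun w => f w - P.eval w) =O[𝓝[>] 0] fun _ => (1 : ℝ) := by
    simpa only [pow_zero] using hP.trans (isBigO_pow_nhdsGT_zero_of_le n.zero_le)
  exact (hsub.add ((tendsto_eval_nhdsGT P 0).isBigO_one ℝ)).congr_left fun w =>
    sub_add_cancel (f w) (P.eval w)

theorem eval (P : ℝ[X]) : HasExpansion n (fun w => P.eval w) P := by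
  simpa only [HasExpansion, sub_self] using isBigO_zero _ _

theorem mul (hP : HasExpansion n f P) (hQ : HasExpansion n g Q) :
    HasExpansion n (fun w => f w * g w) (P * Q) := by
  have hfg := hP.isBigO_one.mul hQ
  have hQf := ((tendsto_eval_nhdsGT Q 0).isBigO_one ℝ).mul hP
  simp only [one_mul] at hfg hQf
  exact (hfg.add hQf).congr_left fun w => by rw [eval_mul]; ring

theorem prod {ι : Type*} (s : Finset ι) {f : ι → ℝ → ℝ} {P : ι → ℝ[X]}
    (h : ∀ i, HasExpansion n (f i) (P i)) :
    HasExpansion n (fun w => ∏ i ∈ s, f i w) (∏ i ∈ s, P i) := by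
  classical
  induction s using Finset.induction_on with
  | empty => simpa using eval (n := n) 1
  | insert i s hi ih => simpa only [Finset.prod_insert hi] using (h i).mul ih

end HasExpansion

theorem isBigO_sub_sum_range_of_hasSum {a : ℕ → ℝ} {d : ℕ} {f : ℝ → ℝ}
    (hf : ∀ w ∈ Set.Icc (0 : ℝ) 1, HasSum (fun j => a j * w ^ (j + d)) (f w)) (n : ℕ) :
    (fun w => f w - ∑ j ∈ Finset.range n, a j * w ^ (j + d)) =O[𝓝[>] 0] fun w => w ^ (n + d) := by
  have summable_abs : Summable fun j => |a j| := by
    simpa using (hf 1 (by simp)).summable.abs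
  refine IsBigO.of_bound (∑' j, |a (j + n)|) ?_
  filter_upwards [Ioc_mem_nhdsGT one_pos] with w hw
  rw [← ((hasSum_nat_add_iff' n).2 (hf w ⟨hw.1.le, hw.2⟩)).tsum_eq,
    Real.norm_of_nonneg (pow_nonneg hw.1.le (n + d)), ← tsum_mul_right]
  refine tsum_of_norm_bounded (((summable_nat_add_iff n).2 summable_abs).mul_right _).hasSum
    fun j => ?_
  rw [Real.norm_eq_abs, abs_mul, abs_of_nonneg (pow_nonneg hw.1.le _)]
  gcongr ?_ * ?_
  exact pow_le_pow_of_le_one hw.1.le hw.2 (by omega)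

theorem hasExpansion_of_hasSum {a : ℕ → ℝ} {f : ℝ → ℝ}
    (hf : ∀ w ∈ Set.Icc (0 : ℝ) 1, HasSum (fun j => a j * w ^ j) (f w)) (n : ℕ) :
    HasExpansion n f (∑ j ∈ Finset.range n, monomial j (a j)) :=
  (isBigO_sub_sum_range_of_hasSum (d := 0) hf n).congr_left fun w => by
    simp [eval_finsetSum, eval_monomial]

theorem hasExpansion_exp_mul_pow (c : ℝ) {d : ℕ} (hd : d ≠ 0) (n : ℕ) :
    HasExpansion n (fun w => Real.exp (c * w ^ d))
      (∑ b : Fin n, monomial (d * b) (c ^ (b : ℕ) / ((b : ℕ).factorial : ℝ))) := by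
  have htaylor := (Real.exp_sub_sum_range_isBigO_pow n).comp_tendsto
    (by simpa using (tendsto_pow_nhdsGT_zero hd).const_mul c)
  have hpow : (fun w : ℝ => (c * w ^ d) ^ n) =O[𝓝[>] 0] fun w => w ^ n := by
    have hle : n ≤ d * n := Nat.le_mul_of_pos_left n (Nat.pos_of_ne_zero hd)
    simpa only [mul_pow, ← pow_mul] using
      (isBigO_pow_nhdsGT_zero_of_le hle).const_mul_left (c ^ n)
  refine (htaylor.trans hpow).congr_left fun w => ?_
  simp only [Function.comp_apply, Finset.sum_range, eval_finsetSum, eval_monomial, mul_pow,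
    pow_mul, div_mul_eq_mul_div]

theorem hasExpansion_exp_one {r : ℝ → ℝ} {n : ℕ} (hn : n ≠ 0)
    (hr : r =O[𝓝[>] 0] fun w => w ^ n) : HasExpansion n (fun w => Real.exp (r w)) 1 := by
  have htaylor := (Real.exp_sub_sum_range_isBigO_pow 1).comp_tendsto
    (hr.trans_tendsto (tendsto_pow_nhdsGT_zero hn))
  simp only [Function.comp_def, Finset.sum_range_one, pow_zero, Nat.factorial_zero, Nat.cast_one,
    div_one, pow_one] at htaylor
  simpa only [HasExpansion, eval_one] using htaylor.trans hr

/-- The coefficient of order `k` of the exponential of a power series with coefficients `c`,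
by expanding the exponential of every monomial. The constant coefficient `c 0` is disregarded. -/
noncomputable def expCoeff (c : ℕ → ℝ) (k : ℕ) : ℝ :=
  ∑ b : Fin k → Fin (k + 1) with ∑ j : Fin k, ((j : ℕ) + 1) * (b j : ℕ) = k,
    ∏ j : Fin k, c ((j : ℕ) + 1) ^ (b j : ℕ) / ((b j : ℕ).factorial : ℝ)

theorem prod_monomial {ι : Type*} (s : Finset ι) (e : ι → ℕ) (a : ι → ℝ) :
    ∏ i ∈ s, monomial (e i) (a i) = monomial (∑ i ∈ s, e i) (∏ i ∈ s, a i) := by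
  simp only [← C_mul_X_pow_eq_monomial, Finset.prod_mul_distrib, Finset.prod_pow_eq_pow_sum,
    map_prod]

theorem coeff_prod_sum_monomial (c : ℕ → ℝ) (k : ℕ) :
    (∏ j : Fin k, ∑ b : Fin (k + 1), monomial (((j : ℕ) + 1) * b)
      (c ((j : ℕ) + 1) ^ (b : ℕ) / ((b : ℕ).factorial : ℝ))).coeff k = expCoeff c k := by
  simp only [Finset.prod_univ_sum, Fintype.piFinset_univ, prod_monomial, finsetSum_coeff,
    coeff_monomial, ← Finset.sum_filter, expCoeff]

theorem eq_mul_expCoeff_of_hasSum {p c : ℕ → ℝ} {K : ℝ} {H : ℝ → ℝ}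
    (hH : ∀ w ∈ Set.Icc (0 : ℝ) 1, HasSum (fun l => c (l + 1) * w ^ (l + 1)) (H w))
    (hp : ∀ w ∈ Set.Icc (0 : ℝ) 1, HasSum (fun k => p k * w ^ k) (K * Real.exp (H w))) (k : ℕ) :
    p k = K * expCoeff c k := by
  set monomials : ℝ → Fin k → ℝ := fun w j => c ((j : ℕ) + 1) * w ^ ((j : ℕ) + 1)
  have hremainder : HasExpansion (k + 1) (fun w => Real.exp (H w - ∑ j, monomials w j)) 1 :=
    hasExpansion_exp_one k.succ_ne_zero <|
      (isBigO_sub_sum_range_of_hasSum hH k).congr_left fun w => by rw [Finset.sum_range]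
  have hmonomials := HasExpansion.prod Finset.univ fun j : Fin k =>
    hasExpansion_exp_mul_pow (c ((j : ℕ) + 1)) (Nat.add_one_ne_zero j) (k + 1)
  have hexp := (HasExpansion.eval (C K)).mul (hremainder.mul hmonomials)
  have hfactor : (fun w => K * Real.exp (H w)) = fun w => (C K).eval w *
      (Real.exp (H w - ∑ j, monomials w j) * ∏ j, Real.exp (monomials w j)) := funext fun w => by
    rw [eval_C, ← Real.exp_sum, ← Real.exp_add, sub_add_cancel]
  rw [← hfactor] at hexp
  have hcoeff := (hasExpansion_of_hasSum hp (k + 1)).coeff_eq hexp k.lt_succ_self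
  simpa [finsetSum_coeff, coeff_monomial, coeff_prod_sum_monomial] using hcoeff

end Expansion

section GeneratingFunction

theorem hasSum_integral_mul_pow {α : Type*} [MeasurableSpace α] {ν : Measure α} {a : ℕ → α → ℝ}
    {A s : α → ℝ} {w : ℝ} (hw : w ∈ Set.Icc (0 : ℝ) 1)
    (ha : ∀ l, AEStronglyMeasurable (a l) ν) (ha_nonneg : ∀ᵐ x ∂ν, ∀ l, 0 ≤ a l x)
    (hs : Integrable s ν) (has : ∀ᵐ x ∂ν, HasSum (fun l => a l x) (s x))
    (hA : ∀ᵐ x ∂ν, HasSum (fun l => a l x * w ^ l) (A x)) :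
    HasSum (fun l => (∫ x, a l x ∂ν) * w ^ l) (∫ x, A x ∂ν) := by
  simp_rw [← integral_mul_const]
  refine hasSum_integral_of_dominated_convergence a (fun l => (ha l).mul_const _) (fun l => ?_)
    (has.mono fun x hx => hx.summable) (hs.congr (has.mono fun x hx => hx.tsum_eq.symm)) hA
  filter_upwards [ha_nonneg] with x hx
  rw [Real.norm_of_nonneg (mul_nonneg (hx l) (pow_nonneg hw.1 l))]
  exact mul_le_of_le_one_right (hx l) (pow_le_one₀ hw.1 hw.2)

theorem hasSum_poisson_mul_pow (y w : ℝ) :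
    HasSum (fun k : ℕ => Real.exp (-y) * y ^ k / (k.factorial : ℝ) * w ^ k)
      (Real.exp (-((1 - w) * y))) := by
  have hexp := (NormedSpace.expSeries_div_hasSum_exp (y * w)).mul_left (Real.exp (-y))
  rw [← Real.exp_eq_exp_ℝ, ← Real.exp_add, show -y + y * w = -((1 - w) * y) by ring] at hexp
  exact hexp.congr_fun fun k => by rw [mul_pow]; ring

theorem hasSum_integral_poisson_mul_pow {Ω : Type*} [MeasurableSpace Ω] {μ : Measure Ω}
    [IsFiniteMeasure μ] {Y : Ω → ℝ} (hY : Measurable Y) (hY_nonneg : ∀ᵐ ω ∂μ, 0 ≤ Y ω) {w : ℝ}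
    (hw : w ∈ Set.Icc (0 : ℝ) 1) :
    HasSum (fun k : ℕ => (∫ ω, Real.exp (-Y ω) * Y ω ^ k / (k.factorial : ℝ) ∂μ) * w ^ k)
      (∫ ω, Real.exp (-((1 - w) * Y ω)) ∂μ) :=
  hasSum_integral_mul_pow (s := 1) hw (fun k => Measurable.aestronglyMeasurable (by fun_prop))
    (hY_nonneg.mono fun ω hω k => by positivity) (integrable_const 1)
    (ae_of_all _ fun ω => by simpa using hasSum_poisson_mul_pow (Y ω) 1)
    (ae_of_all _ fun ω => hasSum_poisson_mul_pow (Y ω) w)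

theorem hasSum_negBinomial_mul_pow {m : ℕ} (hm : 1 ≤ m) {c w : ℝ} (hc : 0 ≤ c)
    (hw : w ∈ Set.Icc (0 : ℝ) 1) :
    HasSum (fun l : ℕ => ((m + l - 1).choose l : ℝ) * (c ^ l * ((1 + c) ^ (m + l))⁻¹) * w ^ l)
      ((1 + (1 - w) * c) ^ m)⁻¹ := by
  obtain ⟨n, rfl⟩ := Nat.exists_eq_add_of_le' hm
  have hratio : ‖c * w / (1 + c)‖ < 1 := by
    rw [Real.norm_of_nonneg (div_nonneg (mul_nonneg hc hw.1) (by positivity)),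
      div_lt_one (by positivity)]
    linarith [mul_le_of_le_one_right hc hw.2]
  have hsum :=
    (hasSum_choose_mul_geometric_of_norm_lt_one n hratio).mul_left ((1 + c) ^ (n + 1))⁻¹
  have hvalue : ((1 + c) ^ (n + 1))⁻¹ * (1 / (1 - c * w / (1 + c)) ^ (n + 1)) =
      ((1 + (1 - w) * c) ^ (n + 1))⁻¹ := by
    rw [one_div, ← mul_inv, ← mul_pow]
    congr 2
    field_simp
    ring
  rw [hvalue] at hsum
  refine hsum.congr_fun fun l => ?_
  rw [show n + 1 + l - 1 = l + n by omega, Nat.choose_symm_add, div_pow, mul_pow, pow_add]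
  field_simp

end GeneratingFunction

namespace Params

variable (S : Params) {i : Hop}

theorem ae_ratio_nonneg (i : Hop) (r₀ : ℝ) :
    ∀ᵐ y ∂volume.restrict (Set.Ioc (S.rMin i ^ 2) (S.rMax i ^ 2)),
      0 ≤ S.theta i * r₀ ^ 2 / y := by
  filter_upwards [ae_restrict_mem measurableSet_Ioc] with y hy
  exact div_nonneg (mul_nonneg (S.theta_pos i).le (sq_nonneg r₀)) ((sq_nonneg _).trans hy.1.le)

theorem hasSum_epsD (hcap : S.CapFits i) (r₀ : ℝ) {w : ℝ} (hw : w ∈ Set.Icc (0 : ℝ) 1) :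
    HasSum (fun l => S.epsD i r₀ l * w ^ l)
      (∫ y in (S.rMin i ^ 2)..(S.rMax i ^ 2),
        ((1 + (1 - w) * (S.theta i * r₀ ^ 2 / y)) ^ S.m i)⁻¹) := by
  simp_rw [epsD, ← intervalIntegral.integral_const_mul,
    intervalIntegral.integral_of_le (S.rMin_sq_le_rMax_sq hcap)]
  refine hasSum_integral_mul_pow (s := 1) hw
    (fun l => Measurable.aestronglyMeasurable (by fun_prop)) ?_ (integrable_const 1) ?_ ?_ <;>
    filter_upwards [S.ae_ratio_nonneg i r₀] with y hy
  · intro l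
    positivity
  · simpa using hasSum_negBinomial_mul_pow (S.m_pos i) hy (w := 1) (by simp)
  · exact hasSum_negBinomial_mul_pow (S.m_pos i) hy hw

/-- The exponent of the Laplace transform at `s` of the normalized interference plus noise of a
link of length `r₀`. -/
noncomputable def laplaceExponent (i : Hop) (r₀ s : ℝ) : ℝ :=
  s * S.Sdot i r₀ + S.Rdot i * ∫ y in (S.rMin i ^ 2)..(S.rMax i ^ 2),
    (1 - ((1 + s * (S.theta i * r₀ ^ 2 / y)) ^ S.m i)⁻¹)

theorem laplaceExponent_one (i : Hop) (r₀ : ℝ) :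
    S.laplaceExponent i r₀ 1 = S.Sdot i r₀ + S.Rdot i * S.eps i r₀ := by
  simp only [laplaceExponent, eps, one_mul]

theorem laplaceExponent_eq_sub (hcap : S.CapFits i) (r₀ : ℝ) {s : ℝ} (hs : 0 ≤ s) :
    S.laplaceExponent i r₀ s = s * S.Sdot i r₀ + S.Rdot i * (S.rMax i ^ 2 - S.rMin i ^ 2 -
      ∫ y in (S.rMin i ^ 2)..(S.rMax i ^ 2), ((1 + s * (S.theta i * r₀ ^ 2 / y)) ^ S.m i)⁻¹) := by
  have hint : IntervalIntegrable (fun y => ((1 + s * (S.theta i * r₀ ^ 2 / y)) ^ S.m i)⁻¹)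
      volume (S.rMin i ^ 2) (S.rMax i ^ 2) := by
    rw [intervalIntegrable_iff_integrableOn_Ioc_of_le (S.rMin_sq_le_rMax_sq hcap)]
    refine Integrable.of_bound (C := 1) (Measurable.aestronglyMeasurable (by fun_prop)) ?_
    filter_upwards [S.ae_ratio_nonneg i r₀] with y hy
    rw [Real.norm_of_nonneg (by positivity)]
    exact inv_le_one_of_one_le₀ (one_le_pow₀ (le_add_of_nonneg_right (mul_nonneg hs hy)))
  rw [laplaceExponent, intervalIntegral.integral_sub intervalIntegrable_const hint,
    intervalIntegral.integral_const, smul_eq_mul, mul_one]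

theorem hasSum_base (hcap : S.CapFits i) (r₀ : ℝ) {w : ℝ} (hw : w ∈ Set.Icc (0 : ℝ) 1) :
    HasSum (fun l => S.base i r₀ (l + 1) * w ^ (l + 1))
      (S.laplaceExponent i r₀ 1 - S.laplaceExponent i r₀ (1 - w)) := by
  have hnoise : HasSum (fun l : ℕ => if l = 0 then S.Sdot i r₀ * w else 0) (S.Sdot i r₀ * w) :=
    hasSum_ite_eq 0 _
  have hinterference :=
    ((hasSum_nat_add_iff' 1).2 (S.hasSum_epsD hcap r₀ hw)).mul_left (S.Rdot i)
  have hepsD_zero : S.epsD i r₀ 0 = ∫ y in (S.rMin i ^ 2)..(S.rMax i ^ 2),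
      ((1 + 1 * (S.theta i * r₀ ^ 2 / y)) ^ S.m i)⁻¹ := by
    simp [epsD]
  rw [S.laplaceExponent_eq_sub hcap r₀ zero_le_one,
    S.laplaceExponent_eq_sub hcap r₀ (sub_nonneg.2 hw.2), ← hepsD_zero]
  convert hnoise.add hinterference using 1
  · ext l
    rcases l with _ | l
    · simp only [base, zero_add, ↓reduceIte, pow_one]
      ring
    · simp only [base, Nat.add_eq_right, Nat.add_eq_zero_iff, one_ne_zero, and_false, ↓reduceIte,
        zero_add]
      ring
  · simp only [Finset.sum_range_one, pow_zero, mul_one]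
    ring

theorem integral_poisson_of_integral_exp_neg (hcap : S.CapFits i) (r₀ : ℝ) {Ω : Type*}
    [MeasurableSpace Ω] {μ : Measure Ω} [IsFiniteMeasure μ] {Y : Ω → ℝ} (hY : Measurable Y)
    (hY_nonneg : ∀ᵐ ω ∂μ, 0 ≤ Y ω)
    (hlaplace : ∀ s ∈ Set.Icc (0 : ℝ) 1,
      ∫ ω, Real.exp (-(s * Y ω)) ∂μ = Real.exp (-S.laplaceExponent i r₀ s)) (k : ℕ) :
    ∫ ω, Real.exp (-Y ω) * Y ω ^ k / (k.factorial : ℝ) ∂μ =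
      Real.exp (-S.laplaceExponent i r₀ 1) * expCoeff (S.base i r₀) k := by
  refine eq_mul_expCoeff_of_hasSum (p := fun k => ∫ ω, Real.exp (-Y ω) * Y ω ^ k / k.factorial ∂μ)
    (fun w hw => S.hasSum_base hcap r₀ hw) (fun w hw => ?_) k
  rw [← Real.exp_add, neg_add_eq_sub, sub_sub_cancel_left,
    ← hlaplace (1 - w) ⟨sub_nonneg.2 hw.2, sub_le_self 1 hw.1⟩]
  exact hasSum_integral_poisson_mul_pow hY hY_nonneg hw

end Params

namespace Params

variable (S : Params) (i : Hop) (u : Space)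

/-- Received power at distance `r`, per unit of the normalized channel power gain
`m / spread * h`. -/
noncomputable def rxScale (r : ℝ) : ℝ :=
  S.P i * S.iota i * S.loss i * S.D i ^ 2 * S.spread i / (16 * S.m i * r ^ 2)

/-- Received power from `x`, relative to that of a link of length `r₀` and in units of the
inverse threshold. -/
noncomputable def weight (r₀ : ℝ) (x : Space) : ℝ :=
  S.theta i * r₀ ^ 2 / dist x (S.receiver i u) ^ 2

/-- The level that the normalized channel power gain of a link of length `r₀` has to exceed for
success, when the interferers are at `x 0, …, x (n - 1)`. Unlike in `sinr`, the channel power gain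
of the interferer at `x k` is `g k`. -/
noncomputable def level (r₀ : ℝ) (n : ℕ) (x : ℕ → Space) (g : ℕ → ℝ) : ℝ :=
  S.Sdot i r₀ + ∑ k ∈ Finset.range n, S.weight i u r₀ (x k) * (S.m i / S.spread i * g k)

theorem rate_pos : 0 < (S.m i : ℝ) / S.spread i :=
  div_pos (Nat.cast_pos.2 (S.m_pos i)) (S.spread_pos i)

theorem rxScale_pos {r : ℝ} (hr : 0 < r) : 0 < S.rxScale i r := by
  have := S.P_pos i
  have := S.iota_pos i
  have := S.loss_pos i
  have := S.D_pos i
  have := S.spread_pos i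
  have : (0 : ℝ) < S.m i := Nat.cast_pos.2 (S.m_pos i)
  rw [rxScale]
  positivity

theorem weight_nonneg (r₀ : ℝ) (x : Space) : 0 ≤ S.weight i u r₀ x :=
  div_nonneg (mul_nonneg (S.theta_pos i).le (sq_nonneg r₀)) (sq_nonneg _)

theorem Sdot_nonneg (r₀ : ℝ) : 0 ≤ S.Sdot i r₀ := by
  have := S.theta_pos i
  have := S.spread_pos i
  have := S.P_pos i
  have := S.iota_pos i
  have := S.loss_pos i
  rw [Sdot]
  positivity

theorem level_nonneg (r₀ : ℝ) (n : ℕ) (x : ℕ → Space) {g : ℕ → ℝ} (hg : ∀ k, 0 ≤ g k) :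
    0 ≤ S.level i u r₀ n x g :=
  add_nonneg (S.Sdot_nonneg i r₀) <| Finset.sum_nonneg fun k _ =>
    mul_nonneg (S.weight_nonneg i u r₀ (x k)) (mul_nonneg (S.rate_pos i).le (hg k))

@[fun_prop]
theorem measurable_weight (r₀ : ℝ) : Measurable (S.weight i u r₀) := by
  unfold weight
  fun_prop

theorem measurable_level (r₀ : ℝ) :
    Measurable fun p : (ℕ × (ℕ → Space)) × (ℕ → ℝ) => S.level i u r₀ p.1.1 p.1.2 p.2 :=
  (measurable_sum_range_marked
    (f := fun q : Space × ℝ => S.weight i u r₀ q.1 * (S.m i / S.spread i * q.2))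
    (by fun_prop)).const_add _

theorem measurable_sinr :
    Measurable fun p : Space × (ℕ × (ℕ → Space)) × (ℕ → ℝ) =>
      S.sinr i u p.1 p.2.1.1 p.2.1.2 p.2.2 := by
  have measurable_rxPower : Measurable fun q : Space × ℝ => S.rxPower i u q.1 q.2 := by
    unfold rxPower pathLoss
    fun_prop
  have measurable_signal : Measurable fun p : Space × (ℕ × (ℕ → Space)) × (ℕ → ℝ) =>
      S.rxPower i u p.1 (p.2.2 0) :=
    measurable_rxPower.comp (f := fun p : Space × (ℕ × (ℕ → Space)) × (ℕ → ℝ) => (p.1, p.2.2 0))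
      (by fun_prop)
  have measurable_interference := (measurable_sum_range_marked measurable_rxPower).comp
    (f := fun p : Space × (ℕ × (ℕ → Space)) × (ℕ → ℝ) => (p.2.1, fun k => p.2.2 (k + 1)))
    (by fun_prop)
  exact measurable_signal.div (measurable_interference.add_const _)

theorem rxPower_eq_rxScale_mul (t : Space) (h : ℝ) :
    S.rxPower i u t h =
      S.rxScale i (dist t (S.receiver i u)) * (S.m i / S.spread i * h) := by
  have := S.c_pos
  have := S.f_pos i
  have := S.spread_pos i
  have : (0 : ℝ) < S.m i := Nat.cast_pos.2 (S.m_pos i)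
  have := Real.pi_pos
  rw [rxPower, gain, pathLoss, rxScale]
  field_simp
  ring

variable {S i u} {r₀ : ℝ}

theorem theta_mul_rxPower (hr₀ : 0 < r₀) (x : Space) (h : ℝ) :
    S.theta i * S.rxPower i u x h =
      S.rxScale i r₀ * (S.weight i u r₀ x * (S.m i / S.spread i * h)) := by
  rw [rxPower_eq_rxScale_mul, rxScale, rxScale, weight]
  field_simp

theorem theta_mul_sigma_sq (hr₀ : 0 < r₀) :
    S.theta i * S.sigma i ^ 2 = S.rxScale i r₀ * S.Sdot i r₀ := by
  have := S.P_pos i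
  have := S.iota_pos i
  have := S.loss_pos i
  have := S.D_pos i
  have := S.spread_pos i
  have : (0 : ℝ) < S.m i := Nat.cast_pos.2 (S.m_pos i)
  rw [rxScale, Sdot]
  field_simp

theorem theta_lt_sinr_iff {t₀ : Space} (ht₀ : 0 < dist t₀ (S.receiver i u)) (n : ℕ)
    (x : ℕ → Space) {g : ℕ → ℝ} (hg : ∀ k, 0 ≤ g k) :
    S.theta i < S.sinr i u t₀ n x g ↔
      S.level i u (dist t₀ (S.receiver i u)) n x (fun k => g (k + 1)) <
        S.m i / S.spread i * g 0 := by
  set r₀ := dist t₀ (S.receiver i u) with hr₀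
  set I := ∑ k ∈ Finset.range n, S.rxPower i u (x k) (g (k + 1))
  have theta_mul_noise : S.theta i * (I + S.sigma i ^ 2) =
      S.rxScale i r₀ * S.level i u r₀ n x (fun k => g (k + 1)) := by
    simp_rw [level, mul_add, I, Finset.mul_sum, theta_mul_rxPower ht₀, theta_mul_sigma_sq ht₀]
    exact add_comm _ _
  have noise_pos : 0 < I + S.sigma i ^ 2 := by
    refine add_pos_of_nonneg_of_pos (Finset.sum_nonneg fun k _ => ?_) (pow_pos (S.sigma_pos i) 2)
    refine nonneg_of_mul_nonneg_right ?_ (S.theta_pos i)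
    rw [theta_mul_rxPower ht₀]
    exact mul_nonneg (S.rxScale_pos i ht₀).le
      (mul_nonneg (S.weight_nonneg i u r₀ _) (mul_nonneg (S.rate_pos i).le (hg _)))
  rw [sinr, lt_div_iff₀ noise_pos, theta_mul_noise, rxPower_eq_rxScale_mul, ← hr₀,
    mul_lt_mul_iff_right₀ (S.rxScale_pos i ht₀)]

end Params

namespace IsLinkModel

variable {S : Params} {i : Hop} {u : Space} {Ω : Type*} [MeasurableSpace Ω] {μ : Measure Ω}
  {T : Ω → Space} {N : Ω → ℕ} {X : ℕ → Ω → Space} {g : ℕ → Ω → ℝ}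

theorem ae_gain_nonneg (h : IsLinkModel S i u μ T N X g) : ∀ᵐ ω ∂μ, ∀ n, 0 ≤ g n ω :=
  ae_all_iff.2 fun n => ae_of_ae_map (h.measurable_gain n).aemeasurable <| by
    rw [h.law_gain n]
    exact ae_nonneg_gammaMeasure _ _

theorem measurable_gains (h : IsLinkModel S i u μ T N X g) : Measurable fun ω n => g n ω :=
  measurable_pi_lambda _ h.measurable_gain

theorem measurable_interfererGains (h : IsLinkModel S i u μ T N X g) :
    Measurable fun ω k => g (k + 1) ω :=
  measurable_pi_lambda _ fun k => h.measurable_gain (k + 1)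

theorem measurable_level (h : IsLinkModel S i u μ T N X g) (r₀ : ℝ) :
    Measurable fun ω => S.level i u r₀ (N ω) (fun n => X n ω) (fun k => g (k + 1) ω) :=
  (S.measurable_level i u r₀).comp (f := fun ω => ((N ω, fun n => X n ω), fun k => g (k + 1) ω))
    (h.poisson.measurable_enumeration.prodMk h.measurable_interfererGains)

theorem ae_level_nonneg (h : IsLinkModel S i u μ T N X g) (r₀ : ℝ) :
    ∀ᵐ ω ∂μ, 0 ≤ S.level i u r₀ (N ω) (fun n => X n ω) (fun k => g (k + 1) ω) :=
  h.ae_gain_nonneg.mono fun _ hω => S.level_nonneg i u r₀ _ _ fun k => hω (k + 1)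

theorem indepFun_level_gain [IsProbabilityMeasure μ] (h : IsLinkModel S i u μ T N X g) (r₀ : ℝ) :
    IndepFun (fun ω => S.level i u r₀ (N ω) (fun n => X n ω) (fun k => g (k + 1) ω)) (g 0) μ := by
  have indep_gains_location :
      IndepFun (fun ω => (g 0 ω, fun k => g (k + 1) ω)) (fun ω => (N ω, fun n => X n ω)) μ :=
    (h.indep_fading.comp (ψ := fun g : ℕ → ℝ => (g 0, fun k => g (k + 1))) measurable_snd
      (by fun_prop)).symm
  have indep_gain := indepFun_prodMk_right (h.measurable_gain 0) h.measurable_interfererGains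
    h.poisson.measurable_enumeration (indepFun_zero_succ h.measurable_gain h.indep_gain)
    indep_gains_location
  exact (indep_gain.comp measurable_id
    ((S.measurable_level i u r₀).comp measurable_swap)).symm

theorem integral_exp_neg_level [IsProbabilityMeasure μ] (h : IsLinkModel S i u μ T N X g)
    (hcap : S.CapFits i) (hu : ‖u‖ = 1) (r₀ : ℝ) {s : ℝ} (hs : 0 ≤ s) :
    ∫ ω, Real.exp (-(s * S.level i u r₀ (N ω) (fun n => X n ω) (fun k => g (k + 1) ω))) ∂μ =
      Real.exp (-S.laplaceExponent i r₀ s) := by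
  -- The absolute value confines `F` to `[0, 1]`; almost surely it changes nothing.
  set F : Space × ℝ → ℝ := fun p =>
    Real.exp (-(s * S.weight i u r₀ p.1 * (S.m i / S.spread i * |p.2|)))
  have weight_nonneg (x : Space) : 0 ≤ s * S.weight i u r₀ x :=
    mul_nonneg hs (S.weight_nonneg i u r₀ x)
  have F_mem (p) : F p ∈ Set.Icc 0 1 := ⟨Real.exp_nonneg _, Real.exp_le_one_iff.2 <|
    neg_nonpos.2 (mul_nonneg (weight_nonneg _) (mul_nonneg (S.rate_pos i).le (abs_nonneg _)))⟩
  have exp_level_eq : ∀ᵐ ω ∂μ,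
      Real.exp (-(s * S.level i u r₀ (N ω) (fun n => X n ω) (fun k => g (k + 1) ω))) =
        Real.exp (-(s * S.Sdot i r₀)) *
          ∏ k ∈ Finset.range (N ω), F (X k ω, g (k + 1) ω) := by
    filter_upwards [h.ae_gain_nonneg] with ω hω
    simp_rw [F, abs_of_nonneg (hω _), ← Real.exp_sum, ← Real.exp_add, Params.level, mul_add,
      Finset.mul_sum, Finset.sum_neg_distrib, neg_add, mul_assoc]
  have integral_F (x : Space) : ∫ y, F (x, y) ∂gammaMeasure (S.m i) (S.m i / S.spread i) =
      ((1 + s * S.weight i u r₀ x) ^ S.m i)⁻¹ := by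
    rw [← integral_exp_neg_mul_mul_gammaMeasure (S.m_pos i) (S.rate_pos i) (weight_nonneg x)]
    refine integral_congr_ae ?_
    filter_upwards [ae_nonneg_gammaMeasure _ _] with y hy
    simp only [F, abs_of_nonneg hy]
  have indep_location :
      IndepFun (fun ω => (N ω, fun n => X n ω)) (fun ω k => g (k + 1) ω) μ :=
    h.indep_fading.comp (φ := Prod.snd) (ψ := fun (g : ℕ → ℝ) k => g (k + 1)) measurable_snd
      (by fun_prop)
  rw [integral_congr_ae exp_level_eq, integral_const_mul,
    h.poisson.integral_prod_marked (fun n => h.measurable_gain (n + 1))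
      (fun n => h.law_gain (n + 1)) (h.indep_gain.precomp (add_left_injective 1))
      indep_location (by fun_prop) F_mem]
  simp_rw [integral_F, Params.weight]
  rw [S.integral_intensity hcap hu
    (f := fun y => 1 - ((1 + s * (S.theta i * r₀ ^ 2 / y)) ^ S.m i)⁻¹) (by fun_prop),
    ← Real.exp_add, ← neg_add, Params.laplaceExponent]

theorem measureReal_sinr [IsProbabilityMeasure μ] (h : IsLinkModel S i u μ T N X g)
    (hcap : S.CapFits i) (hu : ‖u‖ = 1) {t₀ : Space} (ht₀ : t₀ ∈ S.coverage i u) :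
    μ.real {ω | S.theta i < S.sinr i u t₀ (N ω) (fun n => X n ω) (fun n => g n ω)} =
      S.successProb i (dist t₀ (S.receiver i u)) := by
  set r₀ := dist t₀ (S.receiver i u)
  have r₀_pos : 0 < r₀ := S.dist_receiver_pos i hu (S.norm_of_mem_coverage ht₀)
  have sinr_ae_eq :
      {ω | S.theta i < S.sinr i u t₀ (N ω) (fun n => X n ω) (fun n => g n ω)} =ᵐ[μ]
        {ω | S.level i u r₀ (N ω) (fun n => X n ω) (fun k => g (k + 1) ω) <
          S.m i / S.spread i * g 0 ω} := by
    filter_upwards [h.ae_gain_nonneg] with ω hω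
    exact propext (Params.theta_lt_sinr_iff r₀_pos _ _ hω)
  rw [measureReal_congr sinr_ae_eq,
    measureReal_lt_mul_of_map_eq_gammaMeasure (h.measurable_gain 0) (h.measurable_level r₀)
      (h.ae_level_nonneg r₀) (h.indepFun_level_gain r₀) (S.m_pos i) (S.rate_pos i) (h.law_gain 0)]
  simp_rw [S.integral_poisson_of_integral_exp_neg hcap r₀ (h.measurable_level r₀)
    (h.ae_level_nonneg r₀) fun _ hs => h.integral_exp_neg_level hcap hu r₀ hs.1,
    ← Finset.mul_sum, S.laplaceExponent_one, neg_add']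
  rfl

theorem condExp_sinr [IsProbabilityMeasure μ] (h : IsLinkModel S i u μ T N X g)
    (hcap : S.CapFits i) (hu : ‖u‖ = 1) :
    μ⟦{ω | S.theta i < S.sinr i u (T ω) (N ω) (fun n => X n ω) (fun n => g n ω)} |
        MeasurableSpace.comap T inferInstance⟧
      =ᵐ[μ] fun ω => S.successProb i (dist (T ω) (S.receiver i u)) := by
  set V : Ω → (ℕ × (ℕ → Space)) × (ℕ → ℝ) := fun ω => ((N ω, fun n => X n ω), fun n => g n ω)
  set E : Set (Space × (ℕ × (ℕ → Space)) × (ℕ → ℝ)) :=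
    {p | S.theta i < S.sinr i u p.1 p.2.1.1 p.2.1.2 p.2.2}
  have measurable_V : Measurable V := h.poisson.measurable_enumeration.prodMk h.measurable_gains
  have indep_V : IndepFun T V μ :=
    indepFun_prodMk_right h.measurable_tx h.poisson.measurable_enumeration h.measurable_gains
      h.indep_location h.indep_fading
  have measurableSet_E : MeasurableSet E :=
    measurableSet_lt measurable_const (S.measurable_sinr i u)
  refine (condExp_comp_prodMk_of_indepFun h.measurable_tx measurable_V indep_V
    (f := E.indicator fun _ => 1) (measurable_const.indicator measurableSet_E)
    ((integrable_const (1 : ℝ)).indicator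
      ((h.measurable_tx.prodMk measurable_V) measurableSet_E))).trans ?_
  filter_upwards [h.tx_mem] with ω hω
  rw [← h.measureReal_sinr hcap hu hω]
  exact integral_indicator_one ((measurable_const.prodMk measurable_V) measurableSet_E)

end IsLinkModel

end GASS

theorem proposition1 (S : GASS.Params) (i : GASS.Hop) (hcap : S.CapFits i)
    (u : GASS.Space) (hu : ‖u‖ = 1)
    {Ω : Type*} [MeasurableSpace Ω] (μ : Measure Ω) [IsProbabilityMeasure μ]
    (T : Ω → GASS.Space) (N : Ω → ℕ) (X : ℕ → Ω → GASS.Space) (g : ℕ → Ω → ℝ)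
    (hmodel : GASS.IsLinkModel S i u μ T N X g) :
    (∀ t₀ ∈ S.coverage i u,
      μ.real {ω | S.theta i < S.sinr i u t₀ (N ω) (fun n => X n ω) (fun n => g n ω)} =
        S.successProb i (dist t₀ (S.receiver i u))) ∧
    μ⟦{ω | S.theta i < S.sinr i u (T ω) (N ω) (fun n => X n ω) (fun n => g n ω)} |
        MeasurableSpace.comap T inferInstance⟧
      =ᵐ[μ] fun ω => S.successProb i (dist (T ω) (S.receiver i u)) :=
  ⟨fun _ ht => hmodel.measureReal_sinr hcap hu ht, hmodel.condExp_sinr hcap hu⟩
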